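/- **Setting.** Let $d\ge 1$, $\theta>0$, and let $\boldsymbol p=(p_1,\dots,p_d)$ be a probability vector with all $p_j>0$. Let $\boldsymbol u=\{u^{(r)}\}_{r=0}^{d-1}$ be real functions on $\{1,\dots,d\}$ that are orthogonal, $\sum_j u^{(k)}_ju^{(l)}_jp_j=\delta_{kl}a_k$, with $u^{(0)}\equiv 1$ and $u^{(r)}_d=1$ for all $r$, and suppose the hypergroup property $$\mathfrak s(j,k,l)=\sum_{r=0}^{d-1}a_r^{-1}u^{(r)}_ju^{(r)}_ku^{(r)}_l\ge 0,\qquad j,k,l=1,\dots,d.$$ For $\alpha>0$ let $$P(\boldsymbol x;\alpha,\theta,\boldsymbol p)=\frac{\Gamma(\alpha+|\boldsymbol x|)}{\Gamma(\alpha)|\boldsymbol x|!}\frac{\theta^{|\boldsymbol x|}}{(1+\theta)^{\alpha+|\boldsymbol x|}}\binom{|\boldsymbol x|}{\boldsymbol x}\prod_i p_i^{x_i},\qquad \boldsymbol x\in\mathbb Z_+^d,$$ be the multivariate negative binomial (Meixner) distribution. For $\boldsymbol n=(n_0,\dots,n_{d-1})\in\mathbb Z_+^d$ let the multivariate Meixner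 polynomial $M_{\boldsymbol n}(\boldsymbol x)$ be the coefficient of $w_0^{n_0}\cdots w_{d-1}^{n_{d-1}}$ in $$(1-w_0)^{-(|\boldsymbol x|+\alpha)}\prod_{i=1}^d\Big(1-w_0\tfrac{1+\theta}{\theta}+\sum_{j=1}^{d-1}u^{(j)}_iw_j\Big)^{x_i},$$ and let $$h_{\boldsymbol n}^{-1}=\frac{\Gamma(|\boldsymbol n|+\alpha)}{\Gamma(\alpha)\,n_0!\cdots n_{d-1}!}\Big(\frac{1+\theta}{\theta}\Big)^{n_0}\theta^{|\boldsymbol n|-n_0}\prod_{j=1}^{d-1}a_j^{n_j}.$$ A sequence $\rho=(\rho_{\boldsymbol n})$ not depending on $\alpha$ is a *Lancaster sequence* if for all $\alpha>0$ the expansion $$L_\alpha^\rho(\boldsymbol x,\boldsymbol y)=P(\boldsymbol x;\alpha,\theta,\boldsymbol p)P(\boldsymbol y;\alpha,\theta,\boldsymbol p)\Big\{1+\sum_{|\boldsymbol n|\ge1}\rho_{\boldsymbol n}h_{\boldsymbol n}M_{\boldsymbol n}(\boldsymbol x)M_{\boldsymbol n}(\boldsymbol y)\Big\}$$ converges absolutely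 and is non-negative for all $\boldsymbol x,\boldsymbol y\in\mathbb Z_+^d$. Let $S=\{\boldsymbol\xi\in\mathbb R^d:\xi_i\ge 0,\ |\boldsymbol\xi|\le 1\}$, where $|\boldsymbol\xi|=\sum_i\xi_i$. For $\boldsymbol\xi\in S$ put $\rho_j(\boldsymbol\xi)=\sum_{i=1}^d u^{(j)}_i\xi_i$ and $\rho^{\boldsymbol\xi}_{\boldsymbol n}=\prod_{j=0}^{d-1}\rho_j(\boldsymbol\xi)^{n_j}$. Let $K$ be the convex set of all sequences $\rho_{\boldsymbol n}=\mathbb E\big[\rho^{\boldsymbol\xi}_{\boldsymbol n}\big]$ with $\boldsymbol\xi$ a random vector in $S$. Call $(\beta,Q)$ *admissible* if $0\le\beta\le1$ and $Q=(q_{j\mid i})$ is a transition matrix, reversible with respect to $\boldsymbol p$, that has every $u^{(r)}$ as an eigenvector. Write $\kappa=(1-\beta)\theta/(1+\theta)$. **Statement.** 1. The map $\boldsymbol\xi\mapsto\rho^{\boldsymbol\xi}$ is a bijection of $S$ onto the set of extreme points of $K$; that is, the extreme points are the sequences that come from a non-random $\boldsymbol\xi$. 2. Let $\alpha>0$ and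 let $\boldsymbol X,\boldsymbol Y$ be random vectors in $\mathbb Z_+^d$ on a common probability space. There is an extreme point $\rho$ of $K$ that is a Lancaster sequence and satisfies $P(\boldsymbol X=\boldsymbol x,\boldsymbol Y=\boldsymbol y)=L^\rho_\alpha(\boldsymbol x,\boldsymbol y)$ for all $\boldsymbol x,\boldsymbol y$ if and only if $\boldsymbol X$ has the distribution $P(\cdot;\alpha,\theta,\boldsymbol p)$ and there is an admissible $(\beta,Q)$ such that, for all $\boldsymbol x\in\mathbb Z_+^d$ and $\boldsymbol t\in[-1,1]^d$, $$\mathbb E\Big[\prod_j t_j^{Y_j}\,\Big|\,\boldsymbol X=\boldsymbol x\Big]=\frac{(1-\kappa)^\alpha}{\big(1-\kappa\sum_jp_jt_j\big)^\alpha}\prod_{i=1}^d\Bigg(1-\beta+\frac{\beta(1-\kappa)\sum_jq_{j\mid i}t_j}{1-\kappa\sum_jp_jt_j}\Bigg)^{x_i}.$$ 3. For $\boldsymbol\xi\in S\setminus\{\boldsymbol 0\}$ put $$\beta(\boldsymbol\xi)=\frac{|\boldsymbol\xi|}{1+\theta(1-|\boldsymbol\xi|)},\qquad q_{j\mid i}(\boldsymbol\xi)=\frac{p_j\sum_l\frac{\xi_l}{|\boldsymbol\xi|}\mathfrak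 s(i,j,l)-\kappa p_j}{1-\kappa},\qquad \kappa=\frac{(1-\beta(\boldsymbol\xi))\theta}{1+\theta},$$ and put $\beta(\boldsymbol 0)=0$. Then $\boldsymbol\xi\mapsto(\beta(\boldsymbol\xi),Q(\boldsymbol\xi))$ is a bijection from the set of $\boldsymbol\xi\in S\setminus\{\boldsymbol0\}$ for which $\rho^{\boldsymbol\xi}$ is a Lancaster sequence onto the set of admissible $(\beta,Q)$ with $\beta>0$. 4. For admissible $(\beta,Q)$ consider the following birth–death–immigration chain on $\mathbb Z_+^d$. In one step from a configuration $\boldsymbol x$, independently for all individuals, an individual of type $i$ dies with probability $1-\beta$; with probability $\beta$ it survives, changes its type to $j$ with probability $q_{j\mid i}$, and independently gives birth to new individuals according to the probability generating function $(1-\kappa)(1-\kappa\sum_jp_jt_j)^{-1}$; and independent immigrants arrive according to the probability generating function $(1-\kappa)^\alpha(1-\kappa\sum_jp_jt_j)^{-\alpha}$. Then for every $\boldsymbol\xi\in S$ and every admissible $(\beta,Q)$, $$L_\alpha^{\rho^{\boldsymbol\xi}}(\boldsymbol x,\boldsymbol y)=P(\boldsymbol x;\alpha,\theta,\boldsymbol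 p)\,\Pr(\boldsymbol x\to\boldsymbol y)\quad\text{for all }\alpha>0,\ \boldsymbol x,\boldsymbol y\in\mathbb Z_+^d,$$ where $\Pr(\boldsymbol x\to\boldsymbol y)$ is the one-step transition probability of this chain, if and only if $\beta=\beta(\boldsymbol\xi)$ and either $\boldsymbol\xi=\boldsymbol0$ or $Q=Q(\boldsymbol\xi)$. -/

import Mathlib

open MeasureTheory

noncomputable section

namespace MeixnerLancaster

variable {m : ℕ}

/-! Types are indexed by `Fin (m + 1)`, so the dimension is `d = m + 1`.  The orthogonal functions
`u r`, `r = 0, …, d - 1`, are indexed by `Fin (m + 1)` as well, and `u r j` is the value of the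
`r`-th function at the point `j`. -/

/-- `a_r = ∑_j p_j (u_j^{(r)})²`. -/
def sqNorm (p : Fin (m + 1) → ℝ) (u : Fin (m + 1) → Fin (m + 1) → ℝ) (r : Fin (m + 1)) : ℝ :=
  ∑ j, u r j ^ 2 * p j

/-- `s(j,k,l) = ∑_r a_r⁻¹ u_j^{(r)} u_k^{(r)} u_l^{(r)}`. -/
def tripleSum (p : Fin (m + 1) → ℝ) (u : Fin (m + 1) → Fin (m + 1) → ℝ)
    (j k l : Fin (m + 1)) : ℝ :=
  ∑ r, (sqNorm p u r)⁻¹ * u r j * u r k * u r l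

/-- `u` is an orthogonal basis of functions on the points, with respect to the weights `p`, which
starts with the constant function `1`, is scaled to be `1` at the last point, and has the
hypergroup property. -/
structure IsHypergroupBasis (p : Fin (m + 1) → ℝ) (u : Fin (m + 1) → Fin (m + 1) → ℝ) :
    Prop where
  zero_eq_one : ∀ j, u 0 j = 1
  last_eq_one : ∀ r, u r (Fin.last m) = 1
  orthogonal : ∀ k l, k ≠ l → ∑ j, u k j * u l j * p j = 0
  hypergroup : ∀ j k l, 0 ≤ tripleSum p u j k l

/-- The mass function of the multivariate Meixner (negative binomial) distribution, with
probability generating function `(1 - θ ∑_i p_i (s_i - 1))^{-α}`. -/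
def meixnerMass (α θ : ℝ) (p : Fin (m + 1) → ℝ) (x : Fin (m + 1) → ℕ) : ℝ :=
  Real.Gamma (α + ((∑ i, x i : ℕ) : ℝ)) / (Real.Gamma α * ((∑ i, x i).factorial : ℝ))
    * (θ ^ (∑ i, x i) / (1 + θ) ^ (α + ((∑ i, x i : ℕ) : ℝ)))
    * (Nat.multinomial Finset.univ x : ℝ) * ∏ i, p i ^ x i

/-- The multivariate Meixner distribution as a measure. -/
def meixnerMeasure (α θ : ℝ) (p : Fin (m + 1) → ℝ) : Measure (Fin (m + 1) → ℕ) :=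
  Measure.sum fun x => ENNReal.ofReal (meixnerMass α θ p x) • Measure.dirac x

/-- The formal power series `(1 - w₀)^{-c} = ∑_k c (c + 1) ⋯ (c + k - 1) / k! w₀^k` in the
variables `w₀, …, w_{d-1}`. -/
def negPowSeries (m : ℕ) (c : ℝ) : MvPowerSeries (Fin (m + 1)) ℝ := fun n =>
  if ∀ j, j ≠ 0 → n j = 0 then (ascPochhammer ℝ (n 0)).eval c / ((n 0).factorial : ℝ) else 0

/-- The generating function of the multivariate Meixner polynomials at the point `x`,
`(1 - w₀)^{-(|x| + α)} ∏_i (1 - w₀ (1 + θ) / θ + ∑_{j ≥ 1} u_i^{(j)} w_j)^{x_i}`. -/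
def meixnerGenFun (α θ : ℝ) (u : Fin (m + 1) → Fin (m + 1) → ℝ) (x : Fin (m + 1) → ℕ) :
    MvPowerSeries (Fin (m + 1)) ℝ :=
  negPowSeries m (((∑ i, x i : ℕ) : ℝ) + α) *
    ∏ i, (1 - MvPowerSeries.C ((1 + θ) / θ) * MvPowerSeries.X 0
      + ∑ j : Fin m, MvPowerSeries.C (u j.succ i) * MvPowerSeries.X j.succ) ^ x i

/-- The multivariate Meixner polynomial `M_n(x; α, θ, p, u)`, the coefficient of
`w₀^{n₀} ⋯ w_{d-1}^{n_{d-1}}` in the generating function. -/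
def meixnerPoly (α θ : ℝ) (u : Fin (m + 1) → Fin (m + 1) → ℝ) (n : Fin (m + 1) →₀ ℕ)
    (x : Fin (m + 1) → ℕ) : ℝ :=
  MvPowerSeries.coeff n (meixnerGenFun α θ u x)

/-- `h_n(α, θ, u)⁻¹`, the value of `E[M_n(X)²]`. -/
def meixnerNormSq (α θ : ℝ) (p : Fin (m + 1) → ℝ) (u : Fin (m + 1) → Fin (m + 1) → ℝ)
    (n : Fin (m + 1) →₀ ℕ) : ℝ :=
  Real.Gamma (((∑ j, n j : ℕ) : ℝ) + α) / (Real.Gamma α * ∏ j, ((n j).factorial : ℝ))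
    * ((1 + θ) / θ) ^ n 0 * ∏ j : Fin m, (θ * sqNorm p u j.succ) ^ n j.succ

/-- The `n`-th term `ρ_n h_n M_n(x) M_n(y)` of the Lancaster expansion. -/
def lancasterTerm (α θ : ℝ) (p : Fin (m + 1) → ℝ) (u : Fin (m + 1) → Fin (m + 1) → ℝ)
    (ρ : (Fin (m + 1) →₀ ℕ) → ℝ) (x y : Fin (m + 1) → ℕ) (n : Fin (m + 1) →₀ ℕ) : ℝ :=
  ρ n * (meixnerNormSq α θ p u n)⁻¹ * meixnerPoly α θ u n x * meixnerPoly α θ u n y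

/-- `P(x) P(y) {1 + ∑_{|n| ≥ 1} ρ_n h_n M_n(x) M_n(y)}`. -/
def lancasterMass (α θ : ℝ) (p : Fin (m + 1) → ℝ) (u : Fin (m + 1) → Fin (m + 1) → ℝ)
    (ρ : (Fin (m + 1) →₀ ℕ) → ℝ) (x y : Fin (m + 1) → ℕ) : ℝ :=
  meixnerMass α θ p x * meixnerMass α θ p y *
    (1 + ∑' n : {n : Fin (m + 1) →₀ ℕ // n ≠ 0}, lancasterTerm α θ p u ρ x y n)

/-- The sequence `ρ`, which does not depend on `α`, gives a convergent and non-negative Lancaster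
expansion for every `α > 0`. -/
def IsLancasterSequence (θ : ℝ) (p : Fin (m + 1) → ℝ) (u : Fin (m + 1) → Fin (m + 1) → ℝ)
    (ρ : (Fin (m + 1) →₀ ℕ) → ℝ) : Prop :=
  ∀ α : ℝ, 0 < α → ∀ x y : Fin (m + 1) → ℕ,
    (Summable fun n : {n : Fin (m + 1) →₀ ℕ // n ≠ 0} => lancasterTerm α θ p u ρ x y n) ∧
      0 ≤ lancasterMass α θ p u ρ x y

/-- The unit simplex `{ξ : ξ_i ≥ 0, |ξ| ≤ 1}`. -/
def unitSimplex (m : ℕ) : Set (Fin (m + 1) → ℝ) :=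
  {ξ | (∀ i, 0 ≤ ξ i) ∧ ∑ i, ξ i ≤ 1}

/-- `n ↦ ∏_j ρ_j(ξ)^{n_j}`, where `ρ_j(ξ) = ∑_i u_i^{(j)} ξ_i`. -/
def pointSequence (u : Fin (m + 1) → Fin (m + 1) → ℝ) (ξ : Fin (m + 1) → ℝ)
    (n : Fin (m + 1) →₀ ℕ) : ℝ :=
  ∏ j, (∑ i, u j i * ξ i) ^ n j

/-- The convex set of all sequences `n ↦ E[∏_j ρ_j(ξ)^{n_j}]`, with `ξ` a random vector in the
unit simplex. -/
def momentSequences (u : Fin (m + 1) → Fin (m + 1) → ℝ) :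
    Set ((Fin (m + 1) →₀ ℕ) → ℝ) :=
  {ρ | ∃ μ : Measure (Fin (m + 1) → ℝ), IsProbabilityMeasure μ ∧
    (∀ᵐ ξ ∂μ, ξ ∈ unitSimplex m) ∧ ∀ n, ρ n = ∫ ξ, pointSequence u ξ n ∂μ}

/-- `Q i j = q_{j|i}` is a transition matrix, reversible with respect to `p`, and every `u r` is
an eigenvector of `Q`. -/
structure IsReversibleTransition (p : Fin (m + 1) → ℝ) (u : Fin (m + 1) → Fin (m + 1) → ℝ)
    (Q : Matrix (Fin (m + 1)) (Fin (m + 1)) ℝ) : Prop where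
  nonneg : ∀ i j, 0 ≤ Q i j
  row_sum : ∀ i, ∑ j, Q i j = 1
  reversible : ∀ i j, p i * Q i j = p j * Q j i
  eigenvector : ∀ r, ∃ c : ℝ, Q.mulVec (u r) = c • u r

/-- `κ = (1 - β) θ / (1 + θ)`. -/
def kappa (θ β : ℝ) : ℝ := (1 - β) * θ / (1 + θ)

/-- The conditional probability generating function
`(1 - κ)^α (1 - κ ∑ p_j t_j)^{-α}
  ∏_i (1 - β + β (1 - κ) ∑_j q_{j|i} t_j / (1 - κ ∑ p_j t_j))^{x_i}`. -/
def conditionalPgf (α θ β : ℝ) (p : Fin (m + 1) → ℝ) (Q : Matrix (Fin (m + 1)) (Fin (m + 1)) ℝ)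
    (x : Fin (m + 1) → ℕ) (t : Fin (m + 1) → ℝ) : ℝ :=
  (1 - kappa θ β) ^ α / (1 - kappa θ β * ∑ j, p j * t j) ^ α *
    ∏ i, (1 - β + β * (1 - kappa θ β) * (∑ j, Q i j * t j)
      / (1 - kappa θ β * ∑ j, p j * t j)) ^ x i

/-- The law of the descendants of one individual of type `i` in one step: with probability `1 - β`
it dies and leaves nothing; with probability `β` it survives, moves to the type `j` with
probability `q_{j|i}`, and independently gives birth to individuals according to the law with
probability generating function `(1 - κ) (1 - κ ∑ p_j t_j)⁻¹`, which is the multivariate Meixner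
law with `α = 1` and `θ` replaced by `κ / (1 - κ)`. -/
def offspringLaw (β κ : ℝ) (p : Fin (m + 1) → ℝ) (Q : Matrix (Fin (m + 1)) (Fin (m + 1)) ℝ)
    (i : Fin (m + 1)) : Measure (Fin (m + 1) → ℕ) :=
  ENNReal.ofReal (1 - β) • Measure.dirac 0 +
    ENNReal.ofReal β •
      ((∑ j, ENNReal.ofReal (Q i j) • Measure.dirac (Pi.single j 1 : Fin (m + 1) → ℕ)).prod
        (meixnerMeasure 1 (κ / (1 - κ)) p)).map (fun w => w.1 + w.2)

/-- One step from the configuration `x` of the birth-death-immigration chain: the individuals in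
`x` leave independent families of descendants with law `offspringLaw`, and independent immigrants
arrive according to the law with probability generating function
`(1 - κ)^α (1 - κ ∑ p_j t_j)^{-α}`. -/
def bdiTransition (α β κ : ℝ) (p : Fin (m + 1) → ℝ)
    (Q : Matrix (Fin (m + 1)) (Fin (m + 1)) ℝ) (x : Fin (m + 1) → ℕ) :
    Measure (Fin (m + 1) → ℕ) :=
  ((meixnerMeasure α (κ / (1 - κ)) p).prod
    (Measure.pi fun k : (Σ i : Fin (m + 1), Fin (x i)) => offspringLaw β κ p Q k.1)).map
      (fun w => w.1 + ∑ k, w.2 k)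

/-- `β = |ξ| / (1 + θ (1 - |ξ|))`. -/
def betaOf (θ : ℝ) (ξ : Fin (m + 1) → ℝ) : ℝ :=
  (∑ i, ξ i) / (1 + θ * (1 - ∑ i, ξ i))

/-- `q_{j|i} = (p_{j|i}(ω) - κ p_j) / (1 - κ)`, where `p_{j|i}(ω) = p_j ∑_l ω_l s(i,j,l)` and
`ω = ξ / |ξ|`. -/
def transitionOf (θ : ℝ) (p : Fin (m + 1) → ℝ) (u : Fin (m + 1) → Fin (m + 1) → ℝ)
    (ξ : Fin (m + 1) → ℝ) : Matrix (Fin (m + 1)) (Fin (m + 1)) ℝ := fun i j =>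
  (p j * (∑ l, ξ l / (∑ k, ξ k) * tripleSum p u i j l) - kappa θ (betaOf θ ξ) * p j)
    / (1 - kappa θ (betaOf θ ξ))

end MeixnerLancaster

end

noncomputable section

open Filter Topology Finset

namespace MeixnerLancaster

variable {m : ℕ}

theorem hasSum_ascPochhammer (c : ℝ) {z : ℝ} (hz : |z| < 1) :
    HasSum (fun k : ℕ => (ascPochhammer ℝ k).eval c / (k.factorial : ℝ) * z ^ k)
      ((1 - z) ^ (-c)) := by
  have h := (Real.one_div_one_sub_rpow_hasFPowerSeriesOnBall_zero c).hasSum (y := z)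
    (by simpa [enorm_eq_nnnorm] using! hz)
  have hpos : 0 ≤ 1 - z := by have := (abs_lt.mp hz).2; linarith
  simp only [zero_add] at h
  rw [one_div, ← Real.rpow_neg hpos] at h
  refine h.congr_fun ?_
  intro k
  have h1 : ((k.factorial : ℝ)) ≠ 0 := by positivity
  have h2 := Ring.factorial_nsmul_multichoose_eq_ascPochhammer c k
  rw [Polynomial.ascPochhammer_smeval_eq_eval] at h2
  rw [← h2]
  have h3 : c + (k : ℝ) - 1 - k + 1 = c := by ring
  simp [FormalMultilinearSeries.ofScalars, Ring.choose, nsmul_eq_mul, h3]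
  rw [mul_div_cancel_left₀ _ h1]
  exact Or.inl rfl

/-- The negative multinomial series. -/
theorem hasSum_multinomial {ι : Type*} [Fintype ι] [DecidableEq ι] {c : ℝ} (hc : 0 < c)
    {z : ι → ℝ} (hz : ∑ i, |z i| < 1) :
    HasSum (fun n : ι → ℕ => (ascPochhammer ℝ (∑ i, n i)).eval c
      / ((∑ i, n i).factorial : ℝ) * Nat.multinomial univ n * ∏ i, z i ^ n i)
      ((1 - ∑ i, z i) ^ (-c)) := by
  set F : (ι → ℝ) → (ι → ℕ) → ℝ := fun v n => (ascPochhammer ℝ (∑ i, n i)).eval c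
      / ((∑ i, n i).factorial : ℝ) * Nat.multinomial univ n * ∏ i, v i ^ n i with hF
  have key : ∀ v : ι → ℝ, ∀ k : ℕ,
      HasSum (fun n : (fun n : ι → ℕ => ∑ i, n i) ⁻¹' {k} => F v n)
      ((ascPochhammer ℝ k).eval c / (k.factorial : ℝ) * (∑ i, v i) ^ k) := by
    intro v k
    have hs : (fun n : ι → ℕ => ∑ i, n i) ⁻¹' {k} = ↑(piAntidiag (univ : Finset ι) k) := by
      ext n; simp
    have h := Finset.hasSum (piAntidiag univ k) (F v)
    have h2 : ∑ n ∈ piAntidiag univ k, F v n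
        = (ascPochhammer ℝ k).eval c / (k.factorial : ℝ) * (∑ i, v i) ^ k := by
      rw [sum_pow_eq_sum_piAntidiag, mul_sum]
      refine sum_congr rfl fun n hn => ?_
      have : ∑ i, n i = k := (mem_piAntidiag.mp hn).1
      simp only [hF, this]
      ring
    rw [h2] at h
    rw [hs]
    exact h
  have habs : ∀ n, |F z n| = F (fun i => |z i|) n := by
    intro n
    have := (ascPochhammer_pos (∑ i, n i) c hc).le
    simp only [hF, abs_mul, abs_prod, abs_pow, abs_div, Nat.abs_cast, abs_of_nonneg this]
  have hsumm : Summable (F z) := by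
    rw [← summable_abs_iff]
    simp_rw [habs]
    have hnn : 0 ≤ F (fun i => |z i|) := fun n => by rw [← habs]; exact abs_nonneg _
    refine (summable_partition hnn
      (s := fun k => (fun n : ι → ℕ => ∑ i, n i) ⁻¹' {k}) (fun n => ⟨∑ i, n i, by simp, ?_⟩)).2
      ⟨fun k => (key _ k).summable, ?_⟩
    · intro k hk; exact hk.symm
    · simp_rw [fun k => (key (fun i => |z i|) k).tsum_eq]
      refine (hasSum_ascPochhammer c ?_).summable
      rwa [abs_of_nonneg (sum_nonneg fun i _ => abs_nonneg _)]
  have h1 := hsumm.hasSum.tsum_fiberwise (fun n : ι → ℕ => ∑ i, n i)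
  simp_rw [fun k => (key z k).tsum_eq] at h1
  have h2 := hasSum_ascPochhammer c (z := ∑ i, z i) ((abs_sum_le_sum_abs _ _).trans_lt hz)
  rw [← h1.unique h2]
  exact hsumm.hasSum

theorem eq_zero_of_hasSum_pow {f : ℕ → ℝ}
    (h : ∀ᶠ s in 𝓝 (0 : ℝ), HasSum (fun k => f k * s ^ k) 0) : f = 0 := by
  have h1 : HasFPowerSeriesAt (0 : ℝ → ℝ) (FormalMultilinearSeries.ofScalars ℝ f) 0 := by
    rw [hasFPowerSeriesAt_iff]
    filter_upwards [h] with s hs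
    simpa [mul_comm] using hs
  have h2 := h1.eq_zero
  ext n
  have h3 := congrArg (fun p => FormalMultilinearSeries.coeff p n) h2
  rw [FormalMultilinearSeries.coeff_ofScalars] at h3
  exact h3

/-- Uniqueness of the coefficients of a power series in several variables. -/
theorem eq_zero_of_hasSum_prod_pow {d : ℕ} {f : (Fin d → ℕ) → ℝ}
    (h : ∀ᶠ t in 𝓝 (0 : Fin d → ℝ), HasSum (fun y => f y * ∏ i, t i ^ y i) 0) : f = 0 := by
  induction d with
  | zero =>
    have := h.self_of_nhds
    simp only [univ_eq_empty, prod_empty, mul_one] at this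
    ext y
    have h2 := hasSum_single (f := f) y fun z hz => absurd (Subsingleton.elim z y) hz
    exact h2.unique this
  | succ d ih =>
    obtain ⟨ε, hε, hb⟩ := Metric.eventually_nhds_iff.mp h
    have main : ∀ s : ℝ, |s| < ε → ∀ t : Fin d → ℝ, (∀ i, |t i| < ε) →
        HasSum (fun a : ℕ × (Fin d → ℕ) =>
          f (Fin.cons a.1 a.2) * (s ^ a.1 * ∏ i, t i ^ a.2 i)) 0 := by
      intro s hs t ht
      have h1 := @hb (Fin.cons s t) (by
        rw [dist_zero_right, pi_norm_lt_iff hε]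
        intro i
        refine Fin.cases ?_ (fun i => ?_) i
        · simpa using hs
        · simpa using ht i)
      rw [← (Fin.consEquiv fun _ => ℕ).hasSum_iff] at h1
      refine h1.congr_fun fun a => ?_
      simp [Fin.consEquiv, Fin.prod_univ_succ]
    have hfib : ∀ k, ∀ t : Fin d → ℝ, (∀ i, |t i| < ε) →
        Summable (fun y => f (Fin.cons k y) * ∏ i, t i ^ y i) := by
      intro k t ht
      have h1 := (main (ε / 2) (by rw [abs_of_pos (by positivity)]; linarith)
        t ht).summable.prod_factor k
      have h2 := h1.mul_left (((ε / 2) ^ k)⁻¹)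
      refine h2.congr fun y => ?_
      field_simp
    have hz : ∀ k, (fun y => f (Fin.cons k y)) = 0 := by
      intro k
      apply ih
      have : ∀ᶠ t in 𝓝 (0 : Fin d → ℝ), ∀ i, |t i| < ε := by
        filter_upwards [Metric.ball_mem_nhds (0 : Fin d → ℝ) hε] with t ht i
        rw [Metric.mem_ball, dist_zero_right, pi_norm_lt_iff hε] at ht
        exact ht i
      filter_upwards [this] with t ht
      have h0 : (fun k => ∑' y : Fin d → ℕ, f (Fin.cons k y) * ∏ i, t i ^ y i) = 0 := by
        apply eq_zero_of_hasSum_pow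
        have : ∀ᶠ s in 𝓝 (0 : ℝ), |s| < ε := by
          filter_upwards [Metric.ball_mem_nhds (0 : ℝ) hε] with s hs
          simpa using hs
        filter_upwards [this] with s hs
        refine (main s hs t ht).prod_fiberwise fun k => ?_
        convert! (hfib k t ht).hasSum.mul_right (s ^ k) using 1
        ext y
        simp only
        ring
      have h3 := (hfib k t ht).hasSum
      rwa [show (∑' y : Fin d → ℕ, f (Fin.cons k y) * ∏ i, t i ^ y i) = 0 from congrFun h0 k] at h3
    ext y
    have := congrFun (hz (y 0)) (Fin.tail y)
    simpa using this

theorem eq_of_hasSum_prod_pow {d : ℕ} {f g : (Fin d → ℕ) → ℝ} {v : (Fin d → ℝ) → ℝ}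
    (hf : ∀ᶠ t in 𝓝 (0 : Fin d → ℝ), HasSum (fun y => f y * ∏ i, t i ^ y i) (v t))
    (hg : ∀ᶠ t in 𝓝 (0 : Fin d → ℝ), HasSum (fun y => g y * ∏ i, t i ^ y i) (v t)) : f = g := by
  rw [← sub_eq_zero]
  apply eq_zero_of_hasSum_prod_pow
  filter_upwards [hf, hg] with t h1 h2
  have := h1.sub h2
  rw [sub_self] at this
  refine this.congr_fun fun y => ?_
  simp [sub_mul]

/-- The Cauchy product of two real series, with a bound for its absolute values. -/
theorem hasSum_cauchyProduct {A : Type*} [AddCommMonoid A] [HasAntidiagonal A]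
    {F G : A → ℝ} {v v' : ℝ}
    (hf : HasSum F v) (hg : HasSum G v') :
    HasSum (fun n => ∑ kl ∈ HasAntidiagonal.antidiagonal n, F kl.1 * G kl.2) (v * v') ∧
      ∑' n, |∑ kl ∈ HasAntidiagonal.antidiagonal n, F kl.1 * G kl.2|
        ≤ (∑' n, |F n|) * ∑' n, |G n| := by
  have hf' := hf.summable.abs
  have hg' := hg.summable.abs
  have habs : Summable fun x : A × A => |F x.1| * |G x.2| :=
    hf'.mul_of_nonneg hg' (fun _ => abs_nonneg _) (fun _ => abs_nonneg _)
  have hs : Summable fun x : A × A => F x.1 * G x.2 := by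
    rw [← summable_abs_iff]
    simpa only [abs_mul] using habs
  have hS := summable_sum_mul_antidiagonal_of_summable_mul (f := F) (g := G) hs
  have hS' := summable_sum_mul_antidiagonal_of_summable_mul
    (f := fun n => |F n|) (g := fun n => |G n|) habs
  refine ⟨?_, ?_⟩
  · have h := hS.hasSum
    rwa [← hf.summable.tsum_mul_tsum_eq_tsum_sum_antidiagonal hg.summable hs,
      hf.tsum_eq, hg.tsum_eq] at h
  · rw [hf'.tsum_mul_tsum_eq_tsum_sum_antidiagonal hg' habs]
    refine hS.abs.tsum_le_tsum (fun n => ?_) hS'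
    refine (abs_sum_le_sum_abs _ _).trans (le_of_eq ?_)
    simp only [abs_mul]

/-! ### Evaluation of formal power series -/

section EvalsTo

variable {σ : Type*} [Fintype σ]

/-- The series `f` converges absolutely at `w`, to the value `v`, and the absolute values of its
terms add up to at most `B`. -/
structure EvalsTo (f : MvPowerSeries σ ℝ) (w : σ → ℝ) (v B : ℝ) : Prop where
  hasSum : HasSum (fun n => MvPowerSeries.coeff n f * ∏ j, w j ^ n j) v
  bound : ∑' n, |MvPowerSeries.coeff n f * ∏ j, w j ^ n j| ≤ B

variable {f g : MvPowerSeries σ ℝ} {w : σ → ℝ} {v v' B B' : ℝ}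

namespace EvalsTo

theorem summable_abs (h : EvalsTo f w v B) :
    Summable fun n => |MvPowerSeries.coeff n f * ∏ j, w j ^ n j| := h.hasSum.summable.abs

theorem bound_nonneg (h : EvalsTo f w v B) : 0 ≤ B :=
  (tsum_nonneg fun _ => abs_nonneg _).trans h.bound

theorem abs_coeff_le (h : EvalsTo f w v B) (n : σ →₀ ℕ) :
    |MvPowerSeries.coeff n f * ∏ j, w j ^ n j| ≤ B :=
  (h.summable_abs.le_tsum n fun _ _ => abs_nonneg _).trans h.bound

theorem mono (h : EvalsTo f w v B) (hB : B ≤ B') : EvalsTo f w v B' :=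
  ⟨h.hasSum, h.bound.trans hB⟩

theorem monomial (n : σ →₀ ℕ) (c : ℝ) (w : σ → ℝ) :
    EvalsTo (MvPowerSeries.monomial n c) w (c * ∏ j, w j ^ n j) (|c| * ∏ j, |w j| ^ n j) := by
  have h : ∀ k, k ≠ n →
      MvPowerSeries.coeff k (MvPowerSeries.monomial n c) * ∏ j, w j ^ k j = 0 := by
    intro k hk
    classical
    rw [MvPowerSeries.coeff_monomial, if_neg hk, zero_mul]
  refine ⟨?_, ?_⟩
  · convert hasSum_single n h using 1
    rw [MvPowerSeries.coeff_monomial_same]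
  · rw [tsum_eq_single n fun k hk => by rw [h k hk, abs_zero], MvPowerSeries.coeff_monomial_same]
    simp [abs_mul, abs_prod]

theorem C (c : ℝ) (w : σ → ℝ) : EvalsTo (MvPowerSeries.C c) w c |c| := by
  have := monomial (0 : σ →₀ ℕ) c w
  simpa using! this

theorem one (w : σ → ℝ) : EvalsTo (1 : MvPowerSeries σ ℝ) w 1 1 := by
  have := C (1 : ℝ) w
  simpa using this

theorem X (j : σ) (w : σ → ℝ) : EvalsTo (MvPowerSeries.X j) w (w j) |w j| := by
  classical
  have := monomial (Finsupp.single j 1) 1 w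
  simp only [one_mul, abs_one, Finsupp.single_apply, pow_ite, pow_one, pow_zero] at this
  simpa using! this

theorem add (hf : EvalsTo f w v B) (hg : EvalsTo g w v' B') :
    EvalsTo (f + g) w (v + v') (B + B') := by
  have h := hf.hasSum.add hg.hasSum
  simp_rw [← add_mul, ← map_add] at h
  refine ⟨h, ?_⟩
  refine le_trans ?_ (add_le_add hf.bound hg.bound)
  rw [← hf.summable_abs.tsum_add hg.summable_abs]
  refine h.summable.abs.tsum_le_tsum (fun n => ?_) (hf.summable_abs.add hg.summable_abs)
  rw [map_add, add_mul]
  exact abs_add_le _ _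

theorem neg (hf : EvalsTo f w v B) : EvalsTo (-f) w (-v) B := by
  have h := hf.hasSum.neg
  refine ⟨by simpa using h, ?_⟩
  simpa using hf.bound

theorem sub (hf : EvalsTo f w v B) (hg : EvalsTo g w v' B') :
    EvalsTo (f - g) w (v - v') (B + B') := by
  rw [sub_eq_add_neg, sub_eq_add_neg]
  exact hf.add hg.neg

theorem sum {κ : Type*} {s : Finset κ} {F : κ → MvPowerSeries σ ℝ} {V W : κ → ℝ}
    (h : ∀ k ∈ s, EvalsTo (F k) w (V k) (W k)) :
    EvalsTo (∑ k ∈ s, F k) w (∑ k ∈ s, V k) (∑ k ∈ s, W k) := by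
  classical
  induction s using Finset.induction with
  | empty =>
    have := C (0 : ℝ) w
    simpa using this
  | insert a s ha ih =>
    rw [sum_insert ha, sum_insert ha, sum_insert ha]
    exact (h a (mem_insert_self _ _)).add (ih fun k hk => h k (mem_insert_of_mem hk))

theorem mul [DecidableEq σ] (hf : EvalsTo f w v B) (hg : EvalsTo g w v' B') :
    EvalsTo (f * g) w (v * v') (B * B') := by
  have hFG : ∀ n, MvPowerSeries.coeff n (f * g) * ∏ j, w j ^ n j
      = ∑ kl ∈ HasAntidiagonal.antidiagonal n, (MvPowerSeries.coeff kl.1 f * ∏ j, w j ^ kl.1 j) *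
        (MvPowerSeries.coeff kl.2 g * ∏ j, w j ^ kl.2 j) := by
    intro n
    classical
    rw [MvPowerSeries.coeff_mul, sum_mul]
    refine sum_congr rfl fun kl hkl => ?_
    rw [← mem_antidiagonal.mp hkl]
    simp only [Finsupp.add_apply, pow_add, prod_mul_distrib]
    ring
  obtain ⟨h1, h2⟩ := hasSum_cauchyProduct hf.hasSum hg.hasSum
  refine ⟨?_, ?_⟩
  · simp_rw [hFG]
    exact h1
  · simp_rw [hFG]
    exact h2.trans (mul_le_mul hf.bound hg.bound (tsum_nonneg fun _ => abs_nonneg _)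
      hf.bound_nonneg)

theorem pow [DecidableEq σ] (hf : EvalsTo f w v B) (k : ℕ) : EvalsTo (f ^ k) w (v ^ k) (B ^ k) := by
  induction k with
  | zero => simpa using one w
  | succ k ih => simpa only [pow_succ] using ih.mul hf

theorem prod [DecidableEq σ] {κ : Type*} {s : Finset κ} {F : κ → MvPowerSeries σ ℝ} {V W : κ → ℝ}
    (h : ∀ k ∈ s, EvalsTo (F k) w (V k) (W k)) :
    EvalsTo (∏ k ∈ s, F k) w (∏ k ∈ s, V k) (∏ k ∈ s, W k) := by
  classical
  induction s using Finset.induction with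
  | empty => simpa using one w
  | insert a s ha ih =>
    rw [prod_insert ha, prod_insert ha, prod_insert ha]
    exact (h a (mem_insert_self _ _)).mul (ih fun k hk => h k (mem_insert_of_mem hk))

end EvalsTo

end EvalsTo

/-! ### Orthogonal functions with the hypergroup property -/

theorem sqNorm_pos {p : Fin (m + 1) → ℝ} (hp : ∀ i, 0 < p i)
    {u : Fin (m + 1) → Fin (m + 1) → ℝ} (hu : IsHypergroupBasis p u) (r : Fin (m + 1)) :
    0 < sqNorm p u r := by
  refine sum_pos' (fun i _ => mul_nonneg (sq_nonneg _) (hp i).le) ⟨Fin.last m, mem_univ _, ?_⟩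
  rw [hu.last_eq_one]
  simpa using hp _

theorem sqNorm_zero {p : Fin (m + 1) → ℝ} (hp1 : ∑ i, p i = 1)
    {u : Fin (m + 1) → Fin (m + 1) → ℝ} (hu : IsHypergroupBasis p u) : sqNorm p u 0 = 1 := by
  simp [sqNorm, hu.zero_eq_one, hp1]

theorem sum_mul_mul_eq {p : Fin (m + 1) → ℝ}
    {u : Fin (m + 1) → Fin (m + 1) → ℝ} (hu : IsHypergroupBasis p u) (k l : Fin (m + 1)) :
    ∑ j, u k j * u l j * p j = if k = l then sqNorm p u k else 0 := by
  split_ifs with h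
  · subst h
    simp [sqNorm, sq]
  · exact hu.orthogonal k l h

/-- Completeness of the orthogonal functions. -/
theorem sum_sqNorm_inv_mul {p : Fin (m + 1) → ℝ} (hp : ∀ i, 0 < p i)
    {u : Fin (m + 1) → Fin (m + 1) → ℝ} (hu : IsHypergroupBasis p u) (j k : Fin (m + 1)) :
    p j * ∑ r, (sqNorm p u r)⁻¹ * u r j * u r k = if j = k then 1 else 0 := by
  have h : (Matrix.of u) * (Matrix.of fun j r => p j * u r j * (sqNorm p u r)⁻¹) = 1 := by
    ext r s
    rw [Matrix.mul_apply, Matrix.one_apply]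
    have := sum_mul_mul_eq hu r s
    simp only [Matrix.of_apply]
    calc _ = (∑ j, u r j * u s j * p j) * (sqNorm p u s)⁻¹ := by
          rw [sum_mul]; exact sum_congr rfl fun _ _ => by ring
      _ = _ := by
          rw [this]
          split_ifs with h
          · rw [h, mul_inv_cancel₀ (sqNorm_pos hp hu s).ne']
          · simp
  rw [mul_eq_one_comm] at h
  have h2 := congrFun (congrFun h j) k
  rw [Matrix.mul_apply, Matrix.one_apply] at h2
  rw [← h2, mul_sum]
  exact sum_congr rfl fun _ _ => by simp only [Matrix.of_apply]; ring

theorem tripleSum_last {p : Fin (m + 1) → ℝ} (hp : ∀ i, 0 < p i)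
    {u : Fin (m + 1) → Fin (m + 1) → ℝ} (hu : IsHypergroupBasis p u) (j l : Fin (m + 1)) :
    p j * tripleSum p u (Fin.last m) j l = if j = l then 1 else 0 := by
  rw [← sum_sqNorm_inv_mul hp hu, tripleSum]
  simp [hu.last_eq_one]

theorem tripleSum_comm (p : Fin (m + 1) → ℝ) (u : Fin (m + 1) → Fin (m + 1) → ℝ)
    (i j l : Fin (m + 1)) : tripleSum p u i j l = tripleSum p u j i l :=
  sum_congr rfl fun _ _ => by ring

theorem sum_tripleSum_mul {p : Fin (m + 1) → ℝ} (hp : ∀ i, 0 < p i)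
    {u : Fin (m + 1) → Fin (m + 1) → ℝ} (hu : IsHypergroupBasis p u) (i l r : Fin (m + 1)) :
    ∑ j, p j * tripleSum p u i j l * u r j = u r i * u r l := by
  have : ∀ j, p j * tripleSum p u i j l * u r j
      = ∑ s, (sqNorm p u s)⁻¹ * u s i * u s l * (u s j * u r j * p j) := by
    intro j
    rw [tripleSum, mul_sum, sum_mul]
    exact sum_congr rfl fun _ _ => by ring
  simp_rw [this]
  rw [sum_comm]
  simp_rw [← mul_sum, sum_mul_mul_eq hu]
  simp only [mul_ite, mul_zero, sum_ite_eq', mem_univ, if_true]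
  have := (sqNorm_pos hp hu r).ne'
  field_simp

theorem sum_mul_tripleSum {p : Fin (m + 1) → ℝ} (hp : ∀ i, 0 < p i)
    {u : Fin (m + 1) → Fin (m + 1) → ℝ} (hu : IsHypergroupBasis p u) (i l : Fin (m + 1)) :
    ∑ j, p j * tripleSum p u i j l = 1 := by
  have := sum_tripleSum_mul hp hu i l 0
  simpa [hu.zero_eq_one] using this

theorem abs_le_one {p : Fin (m + 1) → ℝ} (hp : ∀ i, 0 < p i)
    {u : Fin (m + 1) → Fin (m + 1) → ℝ} (hu : IsHypergroupBasis p u) (r j : Fin (m + 1)) :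
    |u r j| ≤ 1 := by
  obtain ⟨k, -, hk⟩ := exists_max_image univ (fun j => |u r j|) univ_nonempty
  have h1 : |u r k| * |u r k| ≤ |u r k| := by
    rw [← abs_mul, ← sum_tripleSum_mul hp hu k k r]
    calc _ ≤ ∑ j, p j * tripleSum p u k j k * |u r k| := by
          refine (abs_sum_le_sum_abs _ _).trans (sum_le_sum fun j _ => ?_)
          have h0 : 0 ≤ p j * tripleSum p u k j k := mul_nonneg (hp j).le (hu.hypergroup _ _ _)
          rw [abs_mul, abs_of_nonneg h0]
          exact mul_le_mul_of_nonneg_left (hk j (mem_univ _)) h0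
      _ = |u r k| := by rw [← sum_mul, sum_mul_tripleSum hp hu, one_mul]
  refine (hk j (mem_univ _)).trans ?_
  by_contra h
  nlinarith

/-! ### The Meixner distribution -/

theorem Gamma_add_natCast {α : ℝ} (hα : 0 < α) (n : ℕ) :
    Real.Gamma (α + n) = (ascPochhammer ℝ n).eval α * Real.Gamma α := by
  induction n with
  | zero => simp
  | succ n ih =>
    rw [Nat.cast_succ, ← add_assoc, Real.Gamma_add_one (by positivity), ih, ascPochhammer_succ_eval]
    ring

theorem meixnerMass_eq {α θ : ℝ} (hα : 0 < α) (hθ : 0 ≤ θ) (p : Fin (m + 1) → ℝ)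
    (x : Fin (m + 1) → ℕ) :
    meixnerMass α θ p x = (1 + θ) ^ (-α) * ((ascPochhammer ℝ (∑ i, x i)).eval α
      / ((∑ i, x i).factorial : ℝ) * Nat.multinomial univ x * ∏ i, (θ / (1 + θ) * p i) ^ x i) := by
  have h1 : (0 : ℝ) < 1 + θ := by linarith
  have h2 := (Real.Gamma_pos_of_pos hα).ne'
  have h3 : (1 + θ) ^ α ≠ 0 := (Real.rpow_pos_of_pos h1 _).ne'
  have h4 : ((∑ i, x i).factorial : ℝ) ≠ 0 := by positivity
  rw [meixnerMass, Gamma_add_natCast hα, Real.rpow_add h1, Real.rpow_natCast, Real.rpow_neg h1.le]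
  simp only [mul_pow, prod_mul_distrib, prod_pow_eq_pow_sum]
  rw [div_pow]
  field_simp

theorem meixnerMass_nonneg {α θ : ℝ} (hα : 0 < α) (hθ : 0 ≤ θ) {p : Fin (m + 1) → ℝ}
    (hp : ∀ i, 0 < p i) (x : Fin (m + 1) → ℕ) : 0 ≤ meixnerMass α θ p x := by
  rw [meixnerMass_eq hα hθ]
  have := (ascPochhammer_pos (∑ i, x i) α hα).le
  have h2 : 0 ≤ ∏ i, (θ / (1 + θ) * p i) ^ x i :=
    prod_nonneg fun i _ => pow_nonneg (mul_nonneg (by positivity) (hp i).le) _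
  positivity

theorem meixnerMass_pos {α θ : ℝ} (hα : 0 < α) (hθ : 0 < θ) {p : Fin (m + 1) → ℝ}
    (hp : ∀ i, 0 < p i) (x : Fin (m + 1) → ℕ) : 0 < meixnerMass α θ p x := by
  rw [meixnerMass_eq hα hθ.le]
  have := ascPochhammer_pos (∑ i, x i) α hα
  have h2 : 0 < ∏ i, (θ / (1 + θ) * p i) ^ x i :=
    prod_pos fun i _ => pow_pos (mul_pos (by positivity) (hp i)) _
  have h3 : (0 : ℝ) < Nat.multinomial univ x := by exact_mod_cast Nat.multinomial_pos _ _
  positivity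

theorem hasSum_meixnerMass_mul_pow {α θ : ℝ} (hα : 0 < α) (hθ : 0 ≤ θ) {p : Fin (m + 1) → ℝ}
    (hp : ∀ i, 0 < p i) (hp1 : ∑ i, p i = 1) {t : Fin (m + 1) → ℝ} (ht : ∀ i, |t i| ≤ 1) :
    HasSum (fun y => meixnerMass α θ p y * ∏ i, t i ^ y i)
      ((1 + θ - θ * ∑ i, p i * t i) ^ (-α)) := by
  have h1 : (0 : ℝ) < 1 + θ := by linarith
  have hb : ∑ i, p i * t i ≤ 1 := by
    rw [← hp1]
    exact sum_le_sum fun i _ => mul_le_of_le_one_right (hp i).le (le_of_abs_le (ht i))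
  have hz : ∑ i, |θ / (1 + θ) * p i * t i| < 1 := by
    calc _ ≤ ∑ i, θ / (1 + θ) * p i := by
          refine sum_le_sum fun i _ => ?_
          have : 0 ≤ θ / (1 + θ) * p i := mul_nonneg (by positivity) (hp i).le
          rw [abs_mul, abs_of_nonneg this]
          exact mul_le_of_le_one_right this (ht i)
      _ < 1 := by
          rw [← mul_sum, hp1, mul_one, div_lt_one h1]
          linarith
  have h := (hasSum_multinomial hα hz).mul_left ((1 + θ) ^ (-α))
  rw [← Real.mul_rpow h1.le (by
    have := (le_abs_self _).trans (abs_sum_le_sum_abs (fun i => θ / (1 + θ) * p i * t i) univ)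
    linarith)] at h
  convert! h using 1
  · ext y
    rw [meixnerMass_eq hα hθ]
    simp only [mul_pow, prod_mul_distrib]
    ring
  · congr 1
    simp_rw [mul_assoc, ← mul_sum]
    field_simp

/-! ### The generating function of the Meixner polynomials -/

theorem negPowSeries_evalsTo {c : ℝ} (hc : 0 < c) {w : Fin (m + 1) → ℝ} (hw : |w 0| < 1) :
    EvalsTo (negPowSeries m c) w ((1 - w 0) ^ (-c)) ((1 - |w 0|) ^ (-c)) := by
  have hinj : Function.Injective fun k : ℕ => (Finsupp.single 0 k : Fin (m + 1) →₀ ℕ) :=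
    Finsupp.single_injective 0
  have hout : ∀ n ∉ Set.range (fun k : ℕ => (Finsupp.single 0 k : Fin (m + 1) →₀ ℕ)),
      MvPowerSeries.coeff n (negPowSeries m c) = 0 := by
    intro n hn
    change (if ∀ j, j ≠ 0 → n j = 0 then _ else 0) = 0
    rw [if_neg]
    intro h
    refine hn ⟨n 0, ?_⟩
    ext j
    rcases eq_or_ne j 0 with rfl | hj
    · simp
    · simp [h j hj, hj.symm]
  have hin : ∀ k : ℕ, ∀ z : Fin (m + 1) → ℝ,
      MvPowerSeries.coeff (Finsupp.single 0 k) (negPowSeries m c)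
        * ∏ j, z j ^ (Finsupp.single 0 k : Fin (m + 1) →₀ ℕ) j
      = (ascPochhammer ℝ k).eval c / (k.factorial : ℝ) * z 0 ^ k := by
    intro k z
    have h1 : MvPowerSeries.coeff (Finsupp.single 0 k) (negPowSeries m c)
        = (ascPochhammer ℝ k).eval c / (k.factorial : ℝ) := by
      change (if ∀ j, j ≠ 0 → (Finsupp.single 0 k : Fin (m + 1) →₀ ℕ) j = 0 then _ else 0) = _
      rw [if_pos]
      · simp
      · intro j hj
        simp [hj.symm]
    rw [h1, Fin.prod_univ_succ]
    simp
  have hnn : ∀ n, 0 ≤ MvPowerSeries.coeff n (negPowSeries m c) := by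
    intro n
    change 0 ≤ (if ∀ j, j ≠ 0 → n j = 0 then _ else 0)
    split_ifs
    · exact div_nonneg (ascPochhammer_pos _ _ hc).le (by positivity)
    · exact le_rfl
  have key : ∀ z : Fin (m + 1) → ℝ, |z 0| < 1 →
      HasSum (fun n => MvPowerSeries.coeff n (negPowSeries m c) * ∏ j, z j ^ n j)
        ((1 - z 0) ^ (-c)) := by
    intro z hz
    rw [← hinj.hasSum_iff (fun n hn => by rw [hout n hn, zero_mul])]
    refine (hasSum_ascPochhammer c hz).congr_fun fun k => ?_
    exact hin k z
  refine ⟨key w hw, ?_⟩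
  have h2 := key (fun j => |w j|) (by simpa using hw)
  rw [← h2.tsum_eq]
  refine le_of_eq (tsum_congr fun n => ?_)
  rw [abs_mul, abs_prod, abs_of_nonneg (hnn n)]
  simp

/-- The factor of the generating function that belongs to an individual of type `i`. -/
def genFactor (θ : ℝ) (u : Fin (m + 1) → Fin (m + 1) → ℝ) (w : Fin (m + 1) → ℝ)
    (i : Fin (m + 1)) : ℝ :=
  1 - (1 + θ) / θ * w 0 + ∑ j : Fin m, u j.succ i * w j.succ

/-- A bound for `|genFactor θ u w i|` which is increasing in the `|w j|`. -/
def genFactorBound (θ : ℝ) (w : Fin (m + 1) → ℝ) : ℝ :=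
  1 + (1 + θ) / θ * |w 0| + ∑ j : Fin m, |w j.succ|

theorem meixnerGenFun_evalsTo {α θ : ℝ} (hα : 0 < α) (hθ : 0 < θ) {p : Fin (m + 1) → ℝ}
    (hp : ∀ i, 0 < p i) {u : Fin (m + 1) → Fin (m + 1) → ℝ} (hu : IsHypergroupBasis p u)
    {w : Fin (m + 1) → ℝ} (hw : |w 0| < 1) (x : Fin (m + 1) → ℕ) :
    EvalsTo (meixnerGenFun α θ u x) w
      ((1 - w 0) ^ (-α) * ∏ i, (genFactor θ u w i / (1 - w 0)) ^ x i)
      ((1 - |w 0|) ^ (-α) * ∏ i, (genFactorBound θ w / (1 - |w 0|)) ^ x i) := by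
  have hc : 0 < ((∑ i, x i : ℕ) : ℝ) + α := by positivity
  have hpow : ∀ z : ℝ, |z| < 1 → ∀ v : Fin (m + 1) → ℝ,
      (1 - z) ^ (-(((∑ i, x i : ℕ) : ℝ) + α)) * ∏ i, v i ^ x i
        = (1 - z) ^ (-α) * ∏ i, (v i / (1 - z)) ^ x i := by
    intro z hz v
    have h1 : 0 < 1 - z := by linarith [le_abs_self z]
    rw [neg_add, Real.rpow_add h1, Real.rpow_neg h1.le, Real.rpow_natCast]
    simp only [div_pow, prod_div_distrib, prod_pow_eq_pow_sum]
    ring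
  rw [← hpow _ hw, ← hpow _ (by simpa using hw)]
  refine (negPowSeries_evalsTo hc hw).mul (EvalsTo.prod fun i _ => EvalsTo.pow ?_ _)
  refine (((EvalsTo.one w).sub ((EvalsTo.C _ w).mul (EvalsTo.X 0 w))).add
    (EvalsTo.sum fun j _ => (EvalsTo.C (u j.succ i) w).mul (EvalsTo.X j.succ w))).mono ?_
  rw [abs_of_nonneg (by positivity : 0 ≤ (1 + θ) / θ), genFactorBound]
  gcongr with j
  exact mul_le_of_le_one_left (abs_nonneg _) (abs_le_one hp hu _ _)

theorem abs_genFactor_div_le {θ : ℝ} (hθ : 0 < θ) {p : Fin (m + 1) → ℝ}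
    (hp : ∀ i, 0 < p i) {u : Fin (m + 1) → Fin (m + 1) → ℝ} (hu : IsHypergroupBasis p u)
    {w : Fin (m + 1) → ℝ} (hw : |w 0| < 1) (i : Fin (m + 1)) :
    |genFactor θ u w i / (1 - w 0)| ≤ genFactorBound θ w / (1 - |w 0|) := by
  have h1 : 0 < 1 - |w 0| := by linarith
  have h2 : 1 - |w 0| ≤ |1 - w 0| := by
    have := abs_sub_abs_le_abs_sub 1 (w 0)
    simpa using this
  rw [abs_div]
  refine div_le_div₀ (by unfold genFactorBound; positivity) ?_ h1 h2
  unfold genFactor genFactorBound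
  refine (abs_add_le _ _).trans (add_le_add ((abs_sub _ _).trans ?_) ?_)
  · rw [abs_one, abs_mul, abs_of_nonneg (by positivity : 0 ≤ (1 + θ) / θ)]
  · refine (abs_sum_le_sum_abs _ _).trans (sum_le_sum fun j _ => ?_)
    rw [abs_mul]
    exact mul_le_of_le_one_left (abs_nonneg _) (abs_le_one hp hu _ _)

/-- The factors of `meixnerNormSq`. -/
def normFactor (θ : ℝ) (p : Fin (m + 1) → ℝ) (u : Fin (m + 1) → Fin (m + 1) → ℝ) :
    Fin (m + 1) → ℝ :=
  Fin.cons ((1 + θ) / θ) fun j => θ * sqNorm p u j.succ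

theorem normFactor_pos {θ : ℝ} (hθ : 0 < θ) {p : Fin (m + 1) → ℝ}
    (hp : ∀ i, 0 < p i) {u : Fin (m + 1) → Fin (m + 1) → ℝ} (hu : IsHypergroupBasis p u)
    (j : Fin (m + 1)) : 0 < normFactor θ p u j := by
  refine Fin.cases ?_ (fun j => ?_) j
  · simp only [normFactor, Fin.cons_zero]
    positivity
  · simpa [normFactor] using mul_pos hθ (sqNorm_pos hp hu _)

theorem meixnerNormSq_eq {α : ℝ} (hα : 0 < α) (θ : ℝ) (p : Fin (m + 1) → ℝ)
    (u : Fin (m + 1) → Fin (m + 1) → ℝ) (n : Fin (m + 1) →₀ ℕ) :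
    meixnerNormSq α θ p u n = (ascPochhammer ℝ (∑ j, n j)).eval α / ((∑ j, n j).factorial : ℝ)
      * Nat.multinomial univ n * ∏ j, normFactor θ p u j ^ n j := by
  have h2 := (Real.Gamma_pos_of_pos hα).ne'
  have h3 : ((∑ j, n j).factorial : ℝ) ≠ 0 := by positivity
  have h4 : (∏ j, ((n j).factorial : ℝ)) ≠ 0 := by positivity
  have h5 : (∏ j, ((n j).factorial : ℝ)) * (Nat.multinomial univ n : ℝ)
      = ((∑ j, n j).factorial : ℝ) := by
    exact_mod_cast Nat.multinomial_spec univ n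
  rw [meixnerNormSq, add_comm, Gamma_add_natCast hα,
    Fin.prod_univ_succ (fun j => normFactor θ p u j ^ n j),
    ← h5]
  have h6 : (Nat.multinomial univ n : ℝ) ≠ 0 := by
    exact_mod_cast (Nat.multinomial_pos _ _).ne'
  simp only [normFactor, Fin.cons_zero, Fin.cons_succ]
  field_simp

theorem meixnerNormSq_pos {α θ : ℝ} (hα : 0 < α) (hθ : 0 < θ) {p : Fin (m + 1) → ℝ}
    (hp : ∀ i, 0 < p i) {u : Fin (m + 1) → Fin (m + 1) → ℝ} (hu : IsHypergroupBasis p u)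
    (n : Fin (m + 1) →₀ ℕ) : 0 < meixnerNormSq α θ p u n := by
  rw [meixnerNormSq_eq hα]
  have h1 := ascPochhammer_pos (∑ j, n j) α hα
  have h2 : 0 < ∏ j, normFactor θ p u j ^ n j :=
    prod_pos fun j _ => pow_pos (normFactor_pos hθ hp hu j) _
  have h3 : (0 : ℝ) < Nat.multinomial univ n := by exact_mod_cast Nat.multinomial_pos _ _
  positivity

theorem EvalsTo.summable_weighted {κ σ : Type*} [Fintype σ] {G : κ → MvPowerSeries σ ℝ}
    {w : σ → ℝ} {a V B : κ → ℝ} (h : ∀ y, EvalsTo (G y) w (V y) (B y))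
    (hs : Summable fun y => |a y| * B y) {c : (σ →₀ ℕ) → ℝ} {C : ℝ}
    (hc : ∀ n, |c n| ≤ C * |∏ j, w j ^ n j|) :
    Summable fun q : κ × (σ →₀ ℕ) => a q.1 * (c q.2 * MvPowerSeries.coeff q.2 (G q.1)) := by
  have h1 : Summable fun q : κ × (σ →₀ ℕ) =>
      |a q.1| * |MvPowerSeries.coeff q.2 (G q.1) * ∏ j, w j ^ q.2 j| := by
    refine (summable_prod_of_nonneg (f := fun q : κ × (σ →₀ ℕ) =>
      |a q.1| * |MvPowerSeries.coeff q.2 (G q.1) * ∏ j, w j ^ q.2 j|)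
      fun _ => mul_nonneg (abs_nonneg _) (abs_nonneg _)).2
      ⟨fun y => (h y).summable_abs.mul_left |a y|, ?_⟩
    refine hs.of_nonneg_of_le (fun y => tsum_nonneg fun _ =>
      mul_nonneg (abs_nonneg _) (abs_nonneg _)) fun y => ?_
    dsimp only
    rw [tsum_mul_left]
    exact mul_le_mul_of_nonneg_left (h y).bound (abs_nonneg _)
  refine (h1.mul_left C).of_norm_bounded fun q => ?_
  rw [Real.norm_eq_abs, abs_mul, abs_mul]
  calc _ ≤ |a q.1| * (C * |∏ j, w j ^ q.2 j| * |MvPowerSeries.coeff q.2 (G q.1)|) := by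
        have := hc q.2
        gcongr
    _ = _ := by rw [abs_mul]; ring

theorem hasSum_tsum_swap {κ ν : Type*} {F : κ × ν → ℝ} (h : Summable F) {S : ℝ}
    (hS : HasSum (fun y => ∑' n, F (y, n)) S) : HasSum (fun n => ∑' y, F (y, n)) S := by
  have h1 := h.hasSum.prod_fiberwise fun y => (h.prod_factor y).hasSum
  have h2 := h.prod_symm.hasSum.prod_fiberwise fun n => (h.prod_symm.prod_factor n).hasSum
  have h3 := (Equiv.prodComm ν κ).tsum_eq F
  rw [h1.unique hS] at h3
  convert! h2 using 1
  exact h3.symm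

theorem eq_of_hasSum_finsupp_prod_pow {d : ℕ} {f g : (Fin d →₀ ℕ) → ℝ} {v : (Fin d → ℝ) → ℝ}
    (hf : ∀ᶠ t in 𝓝 (0 : Fin d → ℝ), HasSum (fun y => f y * ∏ i, t i ^ y i) (v t))
    (hg : ∀ᶠ t in 𝓝 (0 : Fin d → ℝ), HasSum (fun y => g y * ∏ i, t i ^ y i) (v t)) : f = g := by
  have h : (fun y => f (Finsupp.equivFunOnFinite.symm y))
      = fun y => g (Finsupp.equivFunOnFinite.symm y) := by
    refine eq_of_hasSum_prod_pow (v := v) ?_ ?_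
    · filter_upwards [hf] with t ht
      rw [← Finsupp.equivFunOnFinite.symm.hasSum_iff] at ht
      exact ht.congr_fun fun y => by simp
    · filter_upwards [hg] with t ht
      rw [← Finsupp.equivFunOnFinite.symm.hasSum_iff] at ht
      exact ht.congr_fun fun y => by simp
  ext y
  have := congrFun h (Finsupp.equivFunOnFinite y)
  simpa using this

/-- The numbers `e_j` for which `∑_y P(y) t^y M_n(y) = h_n⁻¹ Z^{-α} ∏_j e_j^{n_j}`, where
`Z = 1 + θ - θ ∑_i p_i t_i`. -/
def transformBase (θ : ℝ) (p : Fin (m + 1) → ℝ) (u : Fin (m + 1) → Fin (m + 1) → ℝ)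
    (t : Fin (m + 1) → ℝ) : Fin (m + 1) → ℝ :=
  Fin.cons (θ * (1 - ∑ i, p i * t i) / (1 + θ - θ * ∑ i, p i * t i)) fun j =>
    (∑ i, u j.succ i * (p i * t i)) / (sqNorm p u j.succ * (1 + θ - θ * ∑ i, p i * t i))

theorem continuous_genFactorBound (θ : ℝ) :
    Continuous (genFactorBound θ : (Fin (m + 1) → ℝ) → ℝ) := by
  unfold genFactorBound
  fun_prop

theorem sum_mul_le_one {p : Fin (m + 1) → ℝ} (hp : ∀ i, 0 < p i) (hp1 : ∑ i, p i = 1)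
    {t : Fin (m + 1) → ℝ} (ht : ∀ i, |t i| ≤ 1) : ∑ i, p i * t i ≤ 1 := by
  rw [← hp1]
  exact sum_le_sum fun i _ => mul_le_of_le_one_right (hp i).le (le_of_abs_le (ht i))

theorem summable_abs_mass_mul_bound {α θ : ℝ} (hα : 0 < α) (hθ : 0 < θ) {p : Fin (m + 1) → ℝ}
    (hp : ∀ i, 0 < p i) (hp1 : ∑ i, p i = 1) {t w : Fin (m + 1) → ℝ} (hw : |w 0| < 1)
    (ht : ∀ i, |t i| * (genFactorBound θ w / (1 - |w 0|)) ≤ 1) :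
    Summable fun y => |meixnerMass α θ p y * ∏ i, t i ^ y i| *
      ((1 - |w 0|) ^ (-α) * ∏ i, (genFactorBound θ w / (1 - |w 0|)) ^ y i) := by
  have h1 : 0 ≤ genFactorBound θ w / (1 - |w 0|) := by
    have : 0 < 1 - |w 0| := by linarith
    unfold genFactorBound
    positivity
  have := (hasSum_meixnerMass_mul_pow hα hθ.le hp hp1
    (t := fun i => |t i| * (genFactorBound θ w / (1 - |w 0|))) (fun i => by
      rw [abs_of_nonneg (mul_nonneg (abs_nonneg _) h1)]; exact ht i)).summable.mul_left
        ((1 - |w 0|) ^ (-α))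
  refine this.congr fun y => ?_
  rw [abs_mul, abs_of_nonneg (meixnerMass_nonneg hα hθ.le hp y), abs_prod]
  simp only [mul_pow, prod_mul_distrib, abs_pow]
  ring

/-- The transform `∑_y P(y) t^y M_n(y)` of the Meixner polynomials. -/
theorem hasSum_meixnerMass_mul_meixnerPoly {α θ : ℝ} (hα : 0 < α) (hθ : 0 < θ)
    {p : Fin (m + 1) → ℝ} (hp : ∀ i, 0 < p i) (hp1 : ∑ i, p i = 1)
    {u : Fin (m + 1) → Fin (m + 1) → ℝ} (hu : IsHypergroupBasis p u)
    {t : Fin (m + 1) → ℝ} (ht : ∀ i, |t i| < 1) (n : Fin (m + 1) →₀ ℕ) :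
    ∑' y, meixnerMass α θ p y * (∏ i, t i ^ y i) * meixnerPoly α θ u n y =
      meixnerNormSq α θ p u n * ((1 + θ - θ * ∑ i, p i * t i) ^ (-α)
        * ∏ j, transformBase θ p u t j ^ n j) := by
  set T := ∑ i, p i * t i with hT
  set Z := 1 + θ - θ * T with hZdef
  have hT1 : T ≤ 1 := sum_mul_le_one hp hp1 fun i => (ht i).le
  have hZ : 0 < Z := by nlinarith
  have ev1 : ∀ᶠ w in 𝓝 (0 : Fin (m + 1) → ℝ), |w 0| < 1 := by
    have : ContinuousAt (fun w : Fin (m + 1) → ℝ => |w 0|) 0 :=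
      (continuous_apply 0).abs.continuousAt
    exact this.eventually_lt_const (by simp)
  have ev2 : ∀ᶠ w in 𝓝 (0 : Fin (m + 1) → ℝ),
      ∀ i, |t i| * (genFactorBound θ w / (1 - |w 0|)) < 1 := by
    rw [eventually_all]
    intro i
    have : ContinuousAt
        (fun w : Fin (m + 1) → ℝ => |t i| * (genFactorBound θ w / (1 - |w 0|))) 0 := by
      refine continuousAt_const.mul ((continuous_genFactorBound θ).continuousAt.div
        (continuous_const.sub (continuous_apply 0).abs).continuousAt (by simp))
    refine this.eventually_lt_const ?_
    simpa [genFactorBound] using ht i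
  have ev3 : ∀ᶠ w in 𝓝 (0 : Fin (m + 1) → ℝ),
      ∑ j, |normFactor θ p u j * transformBase θ p u t j * w j| < 1 := by
    have : ContinuousAt (fun w : Fin (m + 1) → ℝ =>
      ∑ j, |normFactor θ p u j * transformBase θ p u t j * w j|) 0 :=
      (continuous_finsetSum _ fun j _ =>
        (continuous_const.mul (continuous_apply j)).abs).continuousAt
    exact this.eventually_lt_const (by simp)
  refine congrFun (eq_of_hasSum_finsupp_prod_pow (f := fun n =>
      ∑' y, meixnerMass α θ p y * (∏ i, t i ^ y i) * meixnerPoly α θ u n y)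
    (g := fun n => meixnerNormSq α θ p u n * (Z ^ (-α) * ∏ j, transformBase θ p u t j ^ n j))
    (v := fun w => Z ^ (-α) *
      (1 - ∑ j, normFactor θ p u j * transformBase θ p u t j * w j) ^ (-α)) ?_ ?_) n
  · filter_upwards [ev1, ev2, ev3] with w h1 h2 h3
    have hsum := EvalsTo.summable_weighted
      (fun y => meixnerGenFun_evalsTo hα hθ hp hu h1 y)
      (summable_abs_mass_mul_bound hα hθ hp hp1 h1 fun i => (h2 i).le)
      (c := fun n => ∏ j, w j ^ n j) (C := 1) (fun n => by rw [one_mul])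
    have hw : 0 < 1 - w 0 := by linarith [le_abs_self (w 0)]
    have hti : ∀ i, |t i * (genFactor θ u w i / (1 - w 0))| ≤ 1 := by
      intro i
      rw [abs_mul]
      exact (mul_le_mul_of_nonneg_left (abs_genFactor_div_le hθ hp hu h1 i)
        (abs_nonneg _)).trans (h2 i).le
    have hmass := (hasSum_meixnerMass_mul_pow hα hθ.le hp hp1 hti).mul_left ((1 - w 0) ^ (-α))
    have hle := sum_mul_le_one hp hp1 hti
    have hlt : ∑ j, normFactor θ p u j * transformBase θ p u t j * w j < 1 :=
      ((le_abs_self _).trans (abs_sum_le_sum_abs _ _)).trans_lt h3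
    have hval : (1 - w 0) ^ (-α) *
        (1 + θ - θ * ∑ i, p i * (t i * (genFactor θ u w i / (1 - w 0)))) ^ (-α)
        = Z ^ (-α) * (1 - ∑ j, normFactor θ p u j * transformBase θ p u t j * w j) ^ (-α) := by
      rw [← Real.mul_rpow hw.le (by nlinarith), ← Real.mul_rpow hZ.le (by linarith)]
      congr 1
      have e1 : (1 - w 0) * ∑ i, p i * (t i * (genFactor θ u w i / (1 - w 0)))
          = T * (1 - (1 + θ) / θ * w 0)
            + ∑ j : Fin m, (∑ i, u j.succ i * (p i * t i)) * w j.succ := by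
        simp_rw [sum_mul]
        rw [sum_comm, hT, sum_mul, mul_sum, ← sum_add_distrib]
        refine sum_congr rfl fun i _ => ?_
        have : ∑ j : Fin m, u j.succ i * (p i * t i) * w j.succ
            = p i * t i * ∑ j : Fin m, u j.succ i * w j.succ := by
          rw [mul_sum]
          exact sum_congr rfl fun _ _ => by ring
        rw [this, genFactor]
        field_simp
      have e2 : Z * ∑ j, normFactor θ p u j * transformBase θ p u t j * w j
          = (1 + θ) * (1 - T) * w 0
            + θ * ∑ j : Fin m, (∑ i, u j.succ i * (p i * t i)) * w j.succ := by
        rw [Fin.sum_univ_succ, mul_add, mul_sum, mul_sum]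
        simp only [normFactor, transformBase, Fin.cons_zero, Fin.cons_succ, ← hT, ← hZdef]
        congr 1
        · field_simp
        · refine sum_congr rfl fun j _ => ?_
          have := (sqNorm_pos hp hu j.succ).ne'
          field_simp
      rw [mul_sub, mul_sub, e2, mul_left_comm, e1]
      field_simp
      ring
    rw [hval] at hmass
    refine (hasSum_tsum_swap hsum ?_).congr_fun fun n => ?_
    · refine hmass.congr_fun fun y => ?_
      dsimp only
      rw [tsum_mul_left]
      have := (meixnerGenFun_evalsTo hα hθ hp hu h1 y).hasSum.tsum_eq
      simp_rw [mul_comm (MvPowerSeries.coeff _ _)] at this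
      rw [this]
      simp only [mul_pow, prod_mul_distrib]
      ring
    · rw [← tsum_mul_right]
      refine tsum_congr fun y => ?_
      rw [meixnerPoly]
      ring
  · filter_upwards [ev3] with w h3
    have h := (hasSum_multinomial hα h3).mul_left (Z ^ (-α))
    rw [← Finsupp.equivFunOnFinite.hasSum_iff] at h
    refine h.congr_fun fun n => ?_
    simp only [Function.comp_apply, meixnerNormSq_eq hα, mul_pow, prod_mul_distrib]
    rw [show Finsupp.equivFunOnFinite n = ⇑n from rfl]
    ring

theorem factorial_le_ascPochhammer {α : ℝ} (hα : 0 < α) (k : ℕ) :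
    α * k.factorial ≤ (α + k) * (ascPochhammer ℝ k).eval α := by
  induction k with
  | zero => simp
  | succ k ih =>
    rw [ascPochhammer_succ_eval, Nat.factorial_succ]
    push_cast
    have := (ascPochhammer_pos k α hα).le
    calc α * ((k + 1) * (k.factorial : ℝ)) = (k + 1) * (α * k.factorial) := by ring
      _ ≤ (k + 1) * ((α + k) * (ascPochhammer ℝ k).eval α) := by gcongr
      _ ≤ (α + (k + 1)) * ((α + k) * (ascPochhammer ℝ k).eval α) := by
          refine mul_le_mul_of_nonneg_right (by linarith) (by positivity)
      _ = _ := by ring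

theorem exists_factorial_le_ascPochhammer {α : ℝ} (hα : 0 < α) {q : ℝ} (hq : 1 < q) :
    ∃ C : ℝ, 0 < C ∧ ∀ k : ℕ, (k.factorial : ℝ) ≤ C * q ^ k * (ascPochhammer ℝ k).eval α := by
  refine ⟨1 + 1 / (α * (q - 1)), ?_, fun k => ?_⟩
  · have : 0 < q - 1 := by linarith
    positivity
  · have h0 : 0 < q - 1 := by linarith
    have h1 := factorial_le_ascPochhammer hα k
    have h2 : 1 + (k : ℝ) * (q - 1) ≤ q ^ k := by
      have := one_add_mul_le_pow (a := q - 1) (by linarith) k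
      simpa using this
    have h3 := (ascPochhammer_pos k α hα).le
    have h4 : (k.factorial : ℝ) ≤ (1 + k / α) * (ascPochhammer ℝ k).eval α := by
      have : (1 + k / α) * (ascPochhammer ℝ k).eval α
          = ((α + k) * (ascPochhammer ℝ k).eval α) / α := by field_simp
      rw [this, le_div_iff₀ hα]
      linarith
    refine h4.trans (mul_le_mul_of_nonneg_right ?_ h3)
    calc (1 + k / α : ℝ) ≤ (1 + 1 / (α * (q - 1))) * (1 + k * (q - 1)) := by
          have e : (1 + 1 / (α * (q - 1))) * (1 + k * (q - 1))
            = 1 + k / α + (k * (q - 1) + 1 / (α * (q - 1))) := by field_simp; ring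
          rw [e]
          have : 0 ≤ k * (q - 1) + 1 / (α * (q - 1)) := by positivity
          linarith
      _ ≤ _ := by gcongr

theorem exists_meixnerPoly_div_le {α θ : ℝ} (hα : 0 < α) (hθ : 0 < θ)
    {p : Fin (m + 1) → ℝ} (hp : ∀ i, 0 < p i)
    {u : Fin (m + 1) → Fin (m + 1) → ℝ} (hu : IsHypergroupBasis p u) (x : Fin (m + 1) → ℕ) :
    ∃ (b : Fin (m + 1) → ℝ) (C : ℝ), |b 0| < 1 ∧
      ∀ n, |(meixnerNormSq α θ p u n)⁻¹ * meixnerPoly α θ u n x| ≤ C * |∏ j, b j ^ n j| := by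
  obtain ⟨τ, hτ0, hτ1, hτ⟩ : ∃ τ : ℝ, 0 < τ ∧ τ < 1 ∧ τ ^ 3 = θ / (1 + θ) := by
    have h0 : 0 < θ / (1 + θ) := by positivity
    have h1 : θ / (1 + θ) < 1 := by rw [div_lt_one (by positivity)]; linarith
    refine ⟨(θ / (1 + θ)) ^ ((1 : ℝ) / 3), by positivity,
      Real.rpow_lt_one h0.le h1 (by norm_num), ?_⟩
    rw [← Real.rpow_natCast, ← Real.rpow_mul h0.le]
    norm_num
  obtain ⟨C, hC, hCk⟩ := exists_factorial_le_ascPochhammer hα (one_lt_inv_iff₀.mpr ⟨hτ0, hτ1⟩)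
  set w : Fin (m + 1) → ℝ := Fin.cons τ fun _ => 1 with hw
  have hev := meixnerGenFun_evalsTo hα hθ hp hu (w := w)
    (by simpa [hw, abs_of_pos hτ0] using hτ1) x
  have hwp : ∀ j, 0 < w j := by
    intro j
    refine Fin.cases (by simpa [hw] using hτ0) (fun j => by simp [hw]) j
  set D := (1 - |w 0|) ^ (-α) * ∏ i, (genFactorBound θ w / (1 - |w 0|)) ^ x i with hD
  have hnf := normFactor_pos hθ hp hu
  refine ⟨fun j => τ⁻¹ * (w j)⁻¹ * (normFactor θ p u j)⁻¹, C * D, ?_, fun n => ?_⟩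
  · have : τ⁻¹ * (w 0)⁻¹ * (normFactor θ p u 0)⁻¹ = τ := by
      simp only [hw, normFactor, Fin.cons_zero]
      rw [inv_div, ← hτ]
      field_simp
    simp only
    rwa [this, abs_of_pos hτ0]
  · have hP : 0 < ∏ j, normFactor θ p u j ^ n j := prod_pos fun j _ => pow_pos (hnf j) _
    have hW : 0 < ∏ j, w j ^ n j := prod_pos fun j _ => pow_pos (hwp j) _
    have hb : ∏ j, (τ⁻¹ * (w j)⁻¹ * (normFactor θ p u j)⁻¹) ^ n j
        = τ⁻¹ ^ (∑ j, n j) * (∏ j, w j ^ n j)⁻¹ * (∏ j, normFactor θ p u j ^ n j)⁻¹ := by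
      simp only [mul_pow, prod_mul_distrib, prod_pow_eq_pow_sum, inv_pow, prod_inv_distrib]
    have hpos : 0 < τ⁻¹ ^ (∑ j, n j) * (∏ j, w j ^ n j)⁻¹ * (∏ j, normFactor θ p u j ^ n j)⁻¹ :=
      mul_pos (mul_pos (by positivity) (inv_pos.mpr hW)) (inv_pos.mpr hP)
    rw [hb, abs_of_pos hpos]
    have h1 := hev.abs_coeff_le n
    rw [abs_mul, abs_of_pos hW] at h1
    have h2 : |meixnerPoly α θ u n x| ≤ D * (∏ j, w j ^ n j)⁻¹ := by
      rw [← div_eq_mul_inv, le_div_iff₀ hW]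
      exact h1
    have h3 : (meixnerNormSq α θ p u n)⁻¹
        ≤ C * τ⁻¹ ^ (∑ j, n j) * (∏ j, normFactor θ p u j ^ n j)⁻¹ := by
      have ha := ascPochhammer_pos (∑ j, n j) α hα
      have hmul : (1 : ℝ) ≤ Nat.multinomial univ n := by
        exact_mod_cast Nat.multinomial_pos _ _
      rw [inv_le_comm₀ (meixnerNormSq_pos hα hθ hp hu n)
        (mul_pos (by positivity) (inv_pos.mpr hP)), meixnerNormSq_eq hα]
      rw [mul_inv, inv_inv]
      refine mul_le_mul_of_nonneg_right ?_ hP.le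
      calc (C * τ⁻¹ ^ (∑ j, n j))⁻¹ ≤ (ascPochhammer ℝ (∑ j, n j)).eval α
              / ((∑ j, n j).factorial : ℝ) := by
            rw [inv_le_comm₀ (by positivity) (by positivity), inv_div, div_le_iff₀ ha]
            exact hCk _
        _ ≤ _ := le_mul_of_one_le_right (by positivity) hmul
    rw [abs_mul, abs_of_pos (inv_pos.mpr (meixnerNormSq_pos hα hθ hp hu n))]
    calc _ ≤ (C * τ⁻¹ ^ (∑ j, n j) * (∏ j, normFactor θ p u j ^ n j)⁻¹)
          * (D * (∏ j, w j ^ n j)⁻¹) :=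
          mul_le_mul h3 h2 (abs_nonneg _) (mul_pos (by positivity) (inv_pos.mpr hP)).le
      _ = _ := by ring

theorem abs_sum_mul_le {p : Fin (m + 1) → ℝ} (hp : ∀ i, 0 < p i)
    {u : Fin (m + 1) → Fin (m + 1) → ℝ} (hu : IsHypergroupBasis p u) {ξ : Fin (m + 1) → ℝ}
    (hξ : ξ ∈ unitSimplex m) (j : Fin (m + 1)) : |∑ i, u j i * ξ i| ≤ 1 := by
  refine (abs_sum_le_sum_abs _ _).trans (le_trans (sum_le_sum fun i _ => ?_) hξ.2)
  rw [abs_mul, abs_of_nonneg (hξ.1 i)]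
  exact mul_le_of_le_one_left (hξ.1 i) (abs_le_one hp hu _ _)

theorem abs_pointSequence_le {p : Fin (m + 1) → ℝ} (hp : ∀ i, 0 < p i)
    {u : Fin (m + 1) → Fin (m + 1) → ℝ} (hu : IsHypergroupBasis p u) {ξ : Fin (m + 1) → ℝ}
    (hξ : ξ ∈ unitSimplex m) (n : Fin (m + 1) →₀ ℕ) : |pointSequence u ξ n| ≤ 1 := by
  rw [pointSequence, abs_prod]
  refine prod_le_one (fun _ _ => abs_nonneg _) fun j _ => ?_
  rw [abs_pow]
  exact pow_le_one₀ (abs_nonneg _) (abs_sum_mul_le hp hu hξ j)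

theorem lancasterTerm_eq (α θ : ℝ) (p : Fin (m + 1) → ℝ) (u : Fin (m + 1) → Fin (m + 1) → ℝ)
    (ρ : (Fin (m + 1) →₀ ℕ) → ℝ) (x y : Fin (m + 1) → ℕ) (n : Fin (m + 1) →₀ ℕ) :
    lancasterTerm α θ p u ρ x y n = (ρ n * ((meixnerNormSq α θ p u n)⁻¹ * meixnerPoly α θ u n x))
      * MvPowerSeries.coeff n (meixnerGenFun α θ u y) := by
  rw [lancasterTerm, meixnerPoly, meixnerPoly]
  ring

theorem exists_abs_weight_le {α θ : ℝ} (hα : 0 < α) (hθ : 0 < θ)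
    {p : Fin (m + 1) → ℝ} (hp : ∀ i, 0 < p i)
    {u : Fin (m + 1) → Fin (m + 1) → ℝ} (hu : IsHypergroupBasis p u)
    {ρ : (Fin (m + 1) →₀ ℕ) → ℝ} (hρ : ∀ n, |ρ n| ≤ 1) (x : Fin (m + 1) → ℕ) :
    ∃ (b : Fin (m + 1) → ℝ) (C : ℝ), |b 0| < 1 ∧
      ∀ n, |ρ n * ((meixnerNormSq α θ p u n)⁻¹ * meixnerPoly α θ u n x)|
        ≤ C * |∏ j, b j ^ n j| := by
  obtain ⟨b, C, hb, h⟩ := exists_meixnerPoly_div_le hα hθ hp hu x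
  refine ⟨b, C, hb, fun n => ?_⟩
  rw [abs_mul]
  exact (mul_le_of_le_one_left (abs_nonneg _) (hρ n)).trans (h n)

theorem summable_lancasterTerm {α θ : ℝ} (hα : 0 < α) (hθ : 0 < θ)
    {p : Fin (m + 1) → ℝ} (hp : ∀ i, 0 < p i)
    {u : Fin (m + 1) → Fin (m + 1) → ℝ} (hu : IsHypergroupBasis p u)
    {ρ : (Fin (m + 1) →₀ ℕ) → ℝ} (hρ : ∀ n, |ρ n| ≤ 1) (x y : Fin (m + 1) → ℕ) :
    Summable (lancasterTerm α θ p u ρ x y) := by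
  obtain ⟨b, C, hb, h⟩ := exists_abs_weight_le hα hθ hp hu hρ x
  refine ((meixnerGenFun_evalsTo hα hθ hp hu hb y).summable_abs.mul_left C).of_norm_bounded
    fun n => ?_
  rw [lancasterTerm_eq, Real.norm_eq_abs, abs_mul]
  calc _ ≤ C * |∏ j, b j ^ n j| * |MvPowerSeries.coeff n (meixnerGenFun α θ u y)| :=
        mul_le_mul_of_nonneg_right (h n) (abs_nonneg _)
    _ = _ := by rw [abs_mul]; ring

theorem meixnerPoly_zero (α θ : ℝ) (u : Fin (m + 1) → Fin (m + 1) → ℝ) (x : Fin (m + 1) → ℕ) :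
    meixnerPoly α θ u 0 x = 1 := by
  have h : MvPowerSeries.constantCoeff (negPowSeries m (((∑ i, x i : ℕ) : ℝ) + α)) = 1 := by
    rw [← MvPowerSeries.coeff_zero_eq_constantCoeff_apply]
    change (if _ then _ else _) = _
    simp
  rw [meixnerPoly, MvPowerSeries.coeff_zero_eq_constantCoeff_apply, meixnerGenFun, map_mul, h]
  simp

theorem meixnerNormSq_zero {α : ℝ} (hα : 0 < α) (θ : ℝ) (p : Fin (m + 1) → ℝ)
    (u : Fin (m + 1) → Fin (m + 1) → ℝ) : meixnerNormSq α θ p u 0 = 1 := by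
  rw [meixnerNormSq_eq hα]
  simp [Nat.multinomial]

theorem lancasterMass_eq {α θ : ℝ} (hα : 0 < α) (hθ : 0 < θ)
    {p : Fin (m + 1) → ℝ} (hp : ∀ i, 0 < p i)
    {u : Fin (m + 1) → Fin (m + 1) → ℝ} (hu : IsHypergroupBasis p u)
    {ρ : (Fin (m + 1) →₀ ℕ) → ℝ} (hρ : ∀ n, |ρ n| ≤ 1) (hρ0 : ρ 0 = 1) (x y : Fin (m + 1) → ℕ) :
    lancasterMass α θ p u ρ x y = meixnerMass α θ p x * meixnerMass α θ p y *
      ∑' n, lancasterTerm α θ p u ρ x y n := by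
  have h := (summable_lancasterTerm hα hθ hp hu hρ x y).sum_add_tsum_subtype_compl {0}
  have h0 : lancasterTerm α θ p u ρ x y 0 = 1 := by
    simp [lancasterTerm, hρ0, meixnerNormSq_zero hα, meixnerPoly_zero]
  rw [sum_singleton, h0] at h
  rw [lancasterMass, ← h]
  congr 2
  exact (Equiv.subtypeEquivRight fun n => by simp).tsum_eq
    (fun n : {n : Fin (m + 1) →₀ ℕ // n ∉ ({0} : Finset _)} => lancasterTerm α θ p u ρ x y n)

/-! ### The parameters `(β, Q)` of a point of the simplex -/

theorem one_add_mul_one_sub_pos {θ : ℝ} (hθ : 0 < θ) {ξ : Fin (m + 1) → ℝ}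
    (hξ : ξ ∈ unitSimplex m) : 0 < 1 + θ * (1 - ∑ i, ξ i) := by
  have := hξ.2
  nlinarith

theorem sum_eq_zero_iff_of_mem {ξ : Fin (m + 1) → ℝ} (hξ : ξ ∈ unitSimplex m) :
    ∑ i, ξ i = 0 ↔ ξ = 0 := by
  rw [sum_eq_zero_iff_of_nonneg fun i _ => hξ.1 i]
  simp [funext_iff]

theorem sum_pos_of_mem {ξ : Fin (m + 1) → ℝ} (hξ : ξ ∈ unitSimplex m) (h0 : ξ ≠ 0) :
    0 < ∑ i, ξ i :=
  (sum_nonneg fun i _ => hξ.1 i).lt_of_ne fun h => h0 ((sum_eq_zero_iff_of_mem hξ).1 h.symm)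

theorem one_sub_kappa_betaOf {θ : ℝ} (hθ : 0 < θ) {ξ : Fin (m + 1) → ℝ}
    (hξ : ξ ∈ unitSimplex m) :
    1 - kappa θ (betaOf θ ξ) = (1 + θ * (1 - ∑ i, ξ i))⁻¹ := by
  have h1 := one_add_mul_one_sub_pos hθ hξ
  rw [kappa, betaOf]
  have h2 : (1 + θ) ≠ 0 := by positivity
  field_simp
  ring

theorem betaOf_mem {θ : ℝ} (hθ : 0 < θ) {ξ : Fin (m + 1) → ℝ} (hξ : ξ ∈ unitSimplex m) :
    0 ≤ betaOf θ ξ ∧ betaOf θ ξ ≤ 1 := by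
  have h1 := one_add_mul_one_sub_pos hθ hξ
  have h2 := hξ.2
  refine ⟨div_nonneg (sum_nonneg fun i _ => hξ.1 i) h1.le, ?_⟩
  rw [betaOf, div_le_one h1]
  nlinarith

theorem kappa_mem {θ β : ℝ} (hθ : 0 < θ) (h0 : 0 ≤ β) (h1 : β ≤ 1) :
    0 ≤ kappa θ β ∧ kappa θ β < 1 := by
  rw [kappa]
  refine ⟨div_nonneg (mul_nonneg (by linarith) hθ.le) (by linarith), ?_⟩
  rw [div_lt_one (by linarith)]
  nlinarith

theorem betaOf_zero (θ : ℝ) : betaOf θ (0 : Fin (m + 1) → ℝ) = 0 := by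
  simp [betaOf]

theorem betaOf_pos {θ : ℝ} (hθ : 0 < θ) {ξ : Fin (m + 1) → ℝ}
    (hξ : ξ ∈ unitSimplex m) (h0 : ξ ≠ 0) : 0 < betaOf θ ξ :=
  div_pos (sum_pos_of_mem hξ h0) (one_add_mul_one_sub_pos hθ hξ)

theorem mul_transitionOf {θ : ℝ} (hθ : 0 < θ) (p : Fin (m + 1) → ℝ)
    (u : Fin (m + 1) → Fin (m + 1) → ℝ) {ξ : Fin (m + 1) → ℝ} (hξ : ξ ∈ unitSimplex m)
    (i j : Fin (m + 1)) :
    (∑ k, ξ k) * ((1 - kappa θ (betaOf θ ξ)) * transitionOf θ p u ξ i j)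
      = p j * (∑ l, ξ l * tripleSum p u i j l) - kappa θ (betaOf θ ξ) * (∑ k, ξ k) * p j := by
  by_cases h0 : ξ = 0
  · simp [h0]
  have h1 := (sum_pos_of_mem hξ h0).ne'
  have h2 : 1 - kappa θ (betaOf θ ξ) ≠ 0 := by
    rw [one_sub_kappa_betaOf hθ hξ]
    exact (inv_pos.mpr (one_add_mul_one_sub_pos hθ hξ)).ne'
  rw [transitionOf, mul_div_cancel₀ _ h2, mul_sub]
  congr 1
  · rw [mul_left_comm, mul_sum]
    congr 1
    exact sum_congr rfl fun l _ => by field_simp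
  · ring

theorem sum_tripleSum_weighted (p : Fin (m + 1) → ℝ) (u : Fin (m + 1) → Fin (m + 1) → ℝ)
    (ξ t : Fin (m + 1) → ℝ) (i : Fin (m + 1)) :
    ∑ j, p j * (∑ l, ξ l * tripleSum p u i j l) * t j
      = ∑ r, u r i * ((∑ l, u r l * ξ l) * ((∑ j, u r j * (p j * t j)) / sqNorm p u r)) := by
  have : ∀ r, u r i * ((∑ l, u r l * ξ l) * ((∑ j, u r j * (p j * t j)) / sqNorm p u r))
      = ∑ j, ∑ l, ξ l * ((sqNorm p u r)⁻¹ * u r i * u r j * u r l) * (p j * t j) := by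
    intro r
    rw [div_eq_mul_inv, ← mul_assoc (∑ l, u r l * ξ l), sum_mul_sum, sum_comm, sum_mul, mul_sum]
    refine sum_congr rfl fun j _ => ?_
    rw [sum_mul, mul_sum]
    exact sum_congr rfl fun l _ => by ring
  simp_rw [this]
  rw [sum_comm]
  refine sum_congr rfl fun j _ => ?_
  rw [sum_comm, mul_sum, sum_mul]
  refine sum_congr rfl fun l _ => ?_
  rw [tripleSum, mul_sum, mul_sum, sum_mul]
  exact sum_congr rfl fun r _ => by ring

theorem genFun_eq_conditionalPgf {α θ : ℝ} (hθ : 0 < θ)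
    {p : Fin (m + 1) → ℝ} (hp : ∀ i, 0 < p i) (hp1 : ∑ i, p i = 1)
    {u : Fin (m + 1) → Fin (m + 1) → ℝ} (hu : IsHypergroupBasis p u)
    {ξ : Fin (m + 1) → ℝ} (hξ : ξ ∈ unitSimplex m) {t : Fin (m + 1) → ℝ} (ht : ∀ i, |t i| ≤ 1)
    {w : Fin (m + 1) → ℝ} (hw : w = fun j => (∑ i, u j i * ξ i) * transformBase θ p u t j)
    (hw0 : |w 0| < 1) (x : Fin (m + 1) → ℕ) :
    (1 + θ - θ * ∑ i, p i * t i) ^ (-α) *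
        ((1 - w 0) ^ (-α) * ∏ i, (genFactor θ u w i / (1 - w 0)) ^ x i)
      = conditionalPgf α θ (betaOf θ ξ) p (transitionOf θ p u ξ) x t := by
  set T := ∑ i, p i * t i with hT
  set s := ∑ i, ξ i with hs
  have hT1 : T ≤ 1 := sum_mul_le_one hp hp1 ht
  have hZ : 0 < 1 + θ - θ * T := by nlinarith
  have hD : 0 < 1 + θ * (1 - s) := one_add_mul_one_sub_pos hθ hξ
  have h1w : 0 < 1 - w 0 := by linarith [le_abs_self (w 0)]
  have hκ := one_sub_kappa_betaOf hθ hξ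
  rw [← hs] at hκ
  have hβ : betaOf θ ξ = s / (1 + θ * (1 - s)) := rfl
  have hκ01 := kappa_mem hθ (betaOf_mem hθ hξ).1 (betaOf_mem hθ hξ).2
  have hq := mul_transitionOf hθ p u hξ
  set β := betaOf θ ξ with hβd
  set κ := kappa θ β with hκd
  have hκ1 : 0 < 1 - κ := by linarith [hκ01.2]
  have hκT : 0 < 1 - κ * T := by nlinarith [hκ01.1, hκ01.2]
  have hκe : κ = θ * (1 - s) / (1 + θ * (1 - s)) := by
    have : κ = 1 - (1 - κ) := by ring
    rw [this, hκ]
    field_simp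
    ring
  have hw0e : w 0 = s * (θ * (1 - T) / (1 + θ - θ * T)) := by
    rw [hw]
    simp only [transformBase, Fin.cons_zero, hu.zero_eq_one, one_mul, ← hT, ← hs]
  have e1 : (1 + θ - θ * T) * (1 - w 0) = (1 - κ * T) / (1 - κ) := by
    rw [hκ, hw0e, hκe]
    field_simp
    ring
  rw [← mul_assoc, ← Real.mul_rpow hZ.le h1w.le, e1, conditionalPgf, ← hκd, ← hT,
    ← Real.div_rpow hκ1.le hκT.le, Real.rpow_neg (div_pos hκT hκ1).le,
    ← Real.inv_rpow (div_pos hκT hκ1).le, inv_div]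
  congr 1
  refine prod_congr rfl fun i _ => ?_
  congr 1
  have e2 : (1 + θ - θ * T) * genFactor θ u w i = (1 + θ - θ * T) - (1 + θ) * s * (1 - T)
      + (∑ j, p j * (∑ l, ξ l * tripleSum p u i j l) * t j - s * T / sqNorm p u 0) := by
    rw [sum_tripleSum_weighted, Fin.sum_univ_succ, genFactor, hw0e, mul_add,
      mul_sum univ _ (1 + θ - θ * T)]
    have : u 0 i * ((∑ l, u 0 l * ξ l) * ((∑ j, u 0 j * (p j * t j)) / sqNorm p u 0))
        = s * T / sqNorm p u 0 := by
      simp only [hu.zero_eq_one, one_mul, ← hT, ← hs]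
      ring
    rw [this, add_sub_cancel_left]
    congr 1
    · field_simp
    · refine sum_congr rfl fun j _ => ?_
      rw [hw]
      simp only [transformBase, Fin.cons_succ, ← hT]
      have := (sqNorm_pos hp hu j.succ).ne'
      field_simp
  rw [sqNorm_zero hp1 hu, div_one] at e2
  have e3 : s * ((1 - κ) * ∑ j, transitionOf θ p u ξ i j * t j)
      = ∑ j, p j * (∑ l, ξ l * tripleSum p u i j l) * t j - κ * s * T := by
    rw [hT, mul_sum, mul_sum, mul_sum, ← sum_sub_distrib]
    refine sum_congr rfl fun j _ => ?_
    linear_combination t j * hq i j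
  have e4 : genFactor θ u w i / (1 - w 0)
      = (1 + θ - θ * T) * genFactor θ u w i / ((1 + θ - θ * T) * (1 - w 0)) :=
    (mul_div_mul_left _ _ hZ.ne').symm
  have e5 : β * (1 - κ) * (∑ j, transitionOf θ p u ξ i j * t j)
      = (1 - κ) * (∑ j, p j * (∑ l, ξ l * tripleSum p u i j l) * t j - κ * s * T) := by
    rw [← e3, hκ, hβ]
    field_simp
  rw [e4, e1, e5, e2, div_div_eq_mul_div, ← sub_eq_zero]
  set A := ∑ j, p j * (∑ l, ξ l * tripleSum p u i j l) * t j
  have e6 : 1 - β = (1 - κ) * ((1 + θ) * (1 - s)) := by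
    rw [hκ, hβ]
    field_simp
    ring
  have e7 : κ * (1 + θ * (1 - s)) = θ * (1 - s) := by
    rw [hκe, div_mul_cancel₀ _ hD.ne']
  have e8 : (1 + θ - θ * T) - (1 + θ) * s * (1 - T) + (A - s * T)
      = (1 + θ) * (1 - s) * (1 - κ * T) + (A - κ * s * T) := by
    linear_combination T * e7
  rw [e6, e8]
  field_simp
  ring

theorem eventually_abs_lt_one : ∀ᶠ t in 𝓝 (0 : Fin (m + 1) → ℝ), ∀ i, |t i| < 1 := by
  rw [eventually_all]
  intro i
  exact (continuous_apply i).abs.continuousAt.eventually_lt_const (by simp)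

/-- The generating function of `L(x, ·)` near the origin. -/
theorem hasSum_lancasterMass_mul_pow {α θ : ℝ} (hα : 0 < α) (hθ : 0 < θ)
    {p : Fin (m + 1) → ℝ} (hp : ∀ i, 0 < p i) (hp1 : ∑ i, p i = 1)
    {u : Fin (m + 1) → Fin (m + 1) → ℝ} (hu : IsHypergroupBasis p u)
    {ξ : Fin (m + 1) → ℝ} (hξ : ξ ∈ unitSimplex m) (x : Fin (m + 1) → ℕ) :
    ∀ᶠ t in 𝓝 (0 : Fin (m + 1) → ℝ),
      HasSum (fun y => lancasterMass α θ p u (pointSequence u ξ) x y * ∏ i, t i ^ y i)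
        (meixnerMass α θ p x *
          conditionalPgf α θ (betaOf θ ξ) p (transitionOf θ p u ξ) x t) := by
  have hρ := abs_pointSequence_le hp hu hξ
  have hρ0 : pointSequence u ξ 0 = 1 := by simp [pointSequence]
  obtain ⟨b, C, hb, hbC⟩ := exists_abs_weight_le hα hθ hp hu hρ x
  have ev2 : ∀ᶠ t in 𝓝 (0 : Fin (m + 1) → ℝ),
      ∀ i, |t i| * (genFactorBound θ b / (1 - |b 0|)) < 1 := by
    rw [eventually_all]
    intro i
    exact ((continuous_apply i).abs.mul continuous_const).continuousAt.eventually_lt_const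
      (by simp)
  have ev3 : ∀ᶠ t in 𝓝 (0 : Fin (m + 1) → ℝ),
      |(∑ i, u 0 i * ξ i) * transformBase θ p u t 0| < 1 := by
    have hc : ContinuousAt (fun t : Fin (m + 1) → ℝ =>
        |(∑ i, u 0 i * ξ i) * transformBase θ p u t 0|) 0 := by
      refine (continuousAt_const.mul ?_).abs
      have h : Continuous fun t : Fin (m + 1) → ℝ => ∑ i, p i * t i := by fun_prop
      simp only [transformBase, Fin.cons_zero]
      refine ContinuousAt.div (continuous_const.mul (continuous_const.sub h)).continuousAt
        (continuous_const.sub (continuous_const.mul h)).continuousAt ?_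
      simp only [Pi.zero_apply, mul_zero, sum_const_zero, sub_zero]
      positivity
    refine hc.eventually_lt_const ?_
    dsimp only
    rw [abs_mul]
    refine (mul_le_of_le_one_left (abs_nonneg _) (abs_sum_mul_le hp hu hξ 0)).trans_lt ?_
    simp only [transformBase, Fin.cons_zero, Pi.zero_apply, mul_zero, sum_const_zero, sub_zero,
      mul_one]
    rw [abs_of_pos (by positivity), div_lt_one (by positivity)]
    linarith
  filter_upwards [eventually_abs_lt_one, ev2, ev3] with t h1 h2 h3
  set w : Fin (m + 1) → ℝ := fun j => (∑ i, u j i * ξ i) * transformBase θ p u t j with hw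
  have hsum := EvalsTo.summable_weighted (fun y => meixnerGenFun_evalsTo hα hθ hp hu hb y)
    (summable_abs_mass_mul_bound hα hθ hp hp1 hb fun i => (h2 i).le) hbC
  have hG := (meixnerGenFun_evalsTo hα hθ hp hu (w := w) h3 x).hasSum.mul_left
    ((1 + θ - θ * ∑ i, p i * t i) ^ (-α))
  rw [genFun_eq_conditionalPgf hθ hp hp1 hu hξ (fun i => (h1 i).le) hw h3] at hG
  have hswap := hasSum_tsum_swap hsum.prod_symm
    (hG.congr_fun fun n => ?_)
  · refine (hswap.mul_left (meixnerMass α θ p x)).congr_fun fun y => ?_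
    rw [lancasterMass_eq hα hθ hp hu hρ hρ0]
    simp_rw [lancasterTerm_eq]
    simp only [Prod.swap_prod_mk]
    rw [tsum_mul_left]
    ring
  · simp only [Prod.swap_prod_mk]
    have h := hasSum_meixnerMass_mul_meixnerPoly hα hθ hp hp1 hu h1 n
    simp only [meixnerPoly] at h
    have : ∀ y, meixnerMass α θ p y * (∏ i, t i ^ y i) *
        (pointSequence u ξ n * ((meixnerNormSq α θ p u n)⁻¹ * meixnerPoly α θ u n x) *
          MvPowerSeries.coeff n (meixnerGenFun α θ u y))
        = (pointSequence u ξ n * ((meixnerNormSq α θ p u n)⁻¹ * meixnerPoly α θ u n x)) *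
          (meixnerMass α θ p y * (∏ i, t i ^ y i) *
            MvPowerSeries.coeff n (meixnerGenFun α θ u y)) := fun y => by ring
    simp_rw [this]
    rw [tsum_mul_left, h]
    have hN := (meixnerNormSq_pos hα hθ hp hu n).ne'
    simp only [hw, mul_pow, prod_mul_distrib]
    rw [pointSequence, meixnerPoly]
    field_simp

/-- `Q(ξ)` has all properties of an admissible matrix except possibly non-negativity. -/
theorem isReversibleTransition_transitionOf {θ : ℝ} (hθ : 0 < θ)
    {p : Fin (m + 1) → ℝ} (hp : ∀ i, 0 < p i) (hp1 : ∑ i, p i = 1)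
    {u : Fin (m + 1) → Fin (m + 1) → ℝ} (hu : IsHypergroupBasis p u)
    {ξ : Fin (m + 1) → ℝ} (hξ : ξ ∈ unitSimplex m) (h0 : ξ ≠ 0)
    (hnn : ∀ i j, 0 ≤ transitionOf θ p u ξ i j) :
    IsReversibleTransition p u (transitionOf θ p u ξ) := by
  have hs := (sum_pos_of_mem hξ h0).ne'
  have hκ := kappa_mem hθ (betaOf_mem hθ hξ).1 (betaOf_mem hθ hξ).2
  have hκ1 : 1 - kappa θ (betaOf θ ξ) ≠ 0 := by linarith [hκ.2]
  have key : ∀ i r, ∑ j, transitionOf θ p u ξ i j * u r j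
      = ((∑ l, u r l * ξ l) - kappa θ (betaOf θ ξ) * (∑ k, ξ k) * if r = 0 then 1 else 0)
        / ((∑ k, ξ k) * (1 - kappa θ (betaOf θ ξ))) * u r i := by
    intro i r
    have e1 : (∑ k, ξ k) * ((1 - kappa θ (betaOf θ ξ)) * ∑ j, transitionOf θ p u ξ i j * u r j)
        = ∑ j, p j * (∑ l, ξ l * tripleSum p u i j l) * u r j
          - kappa θ (betaOf θ ξ) * (∑ k, ξ k) * ∑ j, p j * u r j := by
      simp_rw [mul_sum]
      rw [← sum_sub_distrib]
      refine sum_congr rfl fun j _ => ?_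
      have := mul_transitionOf hθ p u hξ i j
      simp_rw [mul_sum] at this
      linear_combination u r j * this
    have e2 : ∑ j, p j * (∑ l, ξ l * tripleSum p u i j l) * u r j
        = u r i * ∑ l, u r l * ξ l := by
      simp_rw [mul_sum, sum_mul]
      rw [sum_comm]
      refine sum_congr rfl fun l _ => ?_
      have := sum_tripleSum_mul hp hu i l r
      calc _ = ξ l * ∑ j, p j * tripleSum p u i j l * u r j := by
            rw [mul_sum]; exact sum_congr rfl fun _ _ => by ring
        _ = _ := by rw [this]; ring
    have e3 : ∑ j, p j * u r j = (if r = 0 then 1 else 0) * u r i := by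
      have := sum_mul_mul_eq hu r 0
      simp only [hu.zero_eq_one, mul_one] at this
      simp_rw [mul_comm (p _)]
      rw [this]
      split_ifs with h
      · rw [h, sqNorm_zero hp1 hu, hu.zero_eq_one, one_mul]
      · rw [zero_mul]
    rw [e2, e3] at e1
    rw [div_mul_eq_mul_div, eq_div_iff (mul_ne_zero hs hκ1)]
    linear_combination e1
  refine ⟨hnn, fun i => ?_, fun i j => ?_, fun r =>
    ⟨((∑ l, u r l * ξ l) - kappa θ (betaOf θ ξ) * (∑ k, ξ k) * if r = 0 then 1 else 0)
        / ((∑ k, ξ k) * (1 - kappa θ (betaOf θ ξ))), funext fun i => ?_⟩⟩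
  · have := key i 0
    simp only [hu.zero_eq_one, mul_one, one_mul, if_true] at this
    rw [this, div_eq_one_iff_eq (mul_ne_zero hs hκ1)]
    ring
  · simp only [transitionOf, tripleSum_comm p u j i]
    ring
  · rw [Pi.smul_apply, smul_eq_mul, ← key i r]
    rfl

/-! ### The birth-death-immigration chain -/

theorem abs_prod_pow_le {t : Fin (m + 1) → ℝ} (ht : ∀ j, |t j| ≤ 1) (y : Fin (m + 1) → ℕ) :
    |∏ j, t j ^ y j| ≤ 1 := by
  rw [abs_prod]
  refine prod_le_one (fun _ _ => abs_nonneg _) fun j _ => ?_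
  rw [abs_pow]
  exact pow_le_one₀ (abs_nonneg _) (ht j)

theorem integrable_prod_pow (μ : Measure (Fin (m + 1) → ℕ)) [IsFiniteMeasure μ]
    {t : Fin (m + 1) → ℝ} (ht : ∀ j, |t j| ≤ 1) : Integrable (fun y => ∏ j, t j ^ y j) μ :=
  Integrable.of_bound (measurable_of_countable _).aestronglyMeasurable 1
    (ae_of_all _ fun y => abs_prod_pow_le ht y)

theorem hasSum_real_mul_prod_pow (μ : Measure (Fin (m + 1) → ℕ)) [IsFiniteMeasure μ]
    {t : Fin (m + 1) → ℝ} (ht : ∀ j, |t j| ≤ 1) :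
    HasSum (fun y => μ.real {y} * ∏ j, t j ^ y j) (∫ y, ∏ j, t j ^ y j ∂μ) := by
  have h := integrable_prod_pow μ ht
  rw [← Measure.sum_smul_dirac μ] at h
  have h2 := hasSum_integral_measure h
  rw [Measure.sum_smul_dirac] at h2
  refine h2.congr_fun fun y => ?_
  rw [integral_smul_measure, integral_dirac, smul_eq_mul, measureReal_def]

theorem measure_ext_of_integral_prod_pow {μ ν : Measure (Fin (m + 1) → ℕ)} [IsFiniteMeasure μ]
    [IsFiniteMeasure ν] (h : ∀ t : Fin (m + 1) → ℝ, (∀ j, |t j| ≤ 1) →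
      ∫ y, ∏ j, t j ^ y j ∂μ = ∫ y, ∏ j, t j ^ y j ∂ν) : μ = ν := by
  have := eq_of_hasSum_prod_pow (f := fun y => μ.real {y}) (g := fun y => ν.real {y})
    (v := fun t => ∫ y, ∏ j, t j ^ y j ∂μ)
    (by filter_upwards [eventually_abs_lt_one] with t ht
        exact hasSum_real_mul_prod_pow μ fun j => (ht j).le)
    (by filter_upwards [eventually_abs_lt_one] with t ht
        rw [h t fun j => (ht j).le]
        exact hasSum_real_mul_prod_pow ν fun j => (ht j).le)
  refine Measure.ext_of_singleton fun y => ?_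
  have h2 := congrFun this y
  simp only [measureReal_def] at h2
  rwa [ENNReal.toReal_eq_toReal_iff' (measure_ne_top _ _) (measure_ne_top _ _)] at h2

theorem meixnerMeasure_singleton (α θ : ℝ) (p : Fin (m + 1) → ℝ) (y : Fin (m + 1) → ℕ) :
    meixnerMeasure α θ p {y} = ENNReal.ofReal (meixnerMass α θ p y) := by
  rw [meixnerMeasure, Measure.sum_smul_dirac_singleton]

theorem hasSum_meixnerMass {α θ : ℝ} (hα : 0 < α) (hθ : 0 ≤ θ) {p : Fin (m + 1) → ℝ}
    (hp : ∀ i, 0 < p i) (hp1 : ∑ i, p i = 1) : HasSum (meixnerMass α θ p) 1 := by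
  have := hasSum_meixnerMass_mul_pow hα hθ hp hp1 (t := fun _ => 1) (by simp)
  simpa [hp1] using this

theorem isProbabilityMeasure_meixnerMeasure {α θ : ℝ} (hα : 0 < α) (hθ : 0 ≤ θ)
    {p : Fin (m + 1) → ℝ} (hp : ∀ i, 0 < p i) (hp1 : ∑ i, p i = 1) :
    IsProbabilityMeasure (meixnerMeasure α θ p) := by
  refine ⟨?_⟩
  have h := hasSum_meixnerMass hα hθ hp hp1
  rw [meixnerMeasure, Measure.sum_apply _ MeasurableSet.univ]
  simp only [Measure.smul_apply, measure_univ, smul_eq_mul, mul_one]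
  rw [← ENNReal.ofReal_tsum_of_nonneg (fun y => meixnerMass_nonneg hα hθ hp y) h.summable,
    h.tsum_eq, ENNReal.ofReal_one]

theorem integral_meixnerMeasure {α κ : ℝ} (hα : 0 < α) (hκ0 : 0 ≤ κ) (hκ1 : κ < 1)
    {p : Fin (m + 1) → ℝ} (hp : ∀ i, 0 < p i) (hp1 : ∑ i, p i = 1) {t : Fin (m + 1) → ℝ}
    (ht : ∀ j, |t j| ≤ 1) :
    ∫ y, ∏ j, t j ^ y j ∂(meixnerMeasure α (κ / (1 - κ)) p)
      = (1 - κ) ^ α / (1 - κ * ∑ j, p j * t j) ^ α := by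
  have h1 : 0 < 1 - κ := by linarith
  have hθ : 0 ≤ κ / (1 - κ) := by positivity
  have := isProbabilityMeasure_meixnerMeasure hα hθ hp hp1
  have h := hasSum_real_mul_prod_pow (meixnerMeasure α (κ / (1 - κ)) p) ht
  have h2 := hasSum_meixnerMass_mul_pow hα hθ hp hp1 ht
  have hT := sum_mul_le_one hp hp1 ht
  have h3 : 0 < 1 - κ * ∑ j, p j * t j := by nlinarith
  simp only [measureReal_def, meixnerMeasure_singleton,
    ENNReal.toReal_ofReal (meixnerMass_nonneg hα hθ hp _)] at h
  rw [h.unique h2, ← Real.div_rpow h1.le h3.le]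
  have h4 : 1 + κ / (1 - κ) - κ / (1 - κ) * ∑ j, p j * t j
      = (1 - κ * ∑ j, p j * t j) / (1 - κ) := by
    field_simp
    ring
  rw [h4, Real.rpow_neg (by positivity), ← Real.inv_rpow (by positivity), inv_div]

theorem integral_prod_pow_map_add (μ ν : Measure (Fin (m + 1) → ℕ)) [SFinite μ] [SFinite ν]
    (t : Fin (m + 1) → ℝ) :
    ∫ y, ∏ j, t j ^ y j ∂((μ.prod ν).map fun w => w.1 + w.2)
      = (∫ y, ∏ j, t j ^ y j ∂μ) * ∫ y, ∏ j, t j ^ y j ∂ν := by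
  rw [integral_map (measurable_of_countable _).aemeasurable
    (measurable_of_countable _).aestronglyMeasurable, ← integral_prod_mul]
  simp only [Pi.add_apply, pow_add, prod_mul_distrib]

theorem isProbabilityMeasure_typeChange {p : Fin (m + 1) → ℝ}
    {u : Fin (m + 1) → Fin (m + 1) → ℝ} {Q : Matrix (Fin (m + 1)) (Fin (m + 1)) ℝ}
    (hQ : IsReversibleTransition p u Q) (i : Fin (m + 1)) :
    IsProbabilityMeasure (∑ j, ENNReal.ofReal (Q i j) •
      Measure.dirac (Pi.single j 1 : Fin (m + 1) → ℕ)) := by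
  refine ⟨?_⟩
  simp only [Measure.coe_finsetSum, Finset.sum_apply, Measure.smul_apply, measure_univ,
    smul_eq_mul, mul_one]
  rw [← ENNReal.ofReal_sum_of_nonneg fun j _ => hQ.nonneg i j, hQ.row_sum, ENNReal.ofReal_one]

theorem integral_typeChange {p : Fin (m + 1) → ℝ}
    {u : Fin (m + 1) → Fin (m + 1) → ℝ} {Q : Matrix (Fin (m + 1)) (Fin (m + 1)) ℝ}
    (hQ : IsReversibleTransition p u Q) (i : Fin (m + 1)) (t : Fin (m + 1) → ℝ) :
    ∫ y, ∏ j, t j ^ y j ∂(∑ j, ENNReal.ofReal (Q i j) •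
      Measure.dirac (Pi.single j 1 : Fin (m + 1) → ℕ)) = ∑ j, Q i j * t j := by
  rw [integral_finsetSum_measure fun j _ => (integrable_dirac (by simp)).smul_measure (by simp)]
  refine sum_congr rfl fun j _ => ?_
  rw [integral_smul_measure, integral_dirac, ENNReal.toReal_ofReal (hQ.nonneg i j), smul_eq_mul]
  congr 1
  rw [prod_eq_single j]
  · simp
  · intro k _ hk
    simp [hk]
  · simp

theorem isProbabilityMeasure_offspringLaw {β κ : ℝ} (hβ0 : 0 ≤ β) (hβ1 : β ≤ 1) (hκ0 : 0 ≤ κ)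
    (hκ1 : κ < 1) {p : Fin (m + 1) → ℝ} (hp : ∀ i, 0 < p i) (hp1 : ∑ i, p i = 1)
    {u : Fin (m + 1) → Fin (m + 1) → ℝ} {Q : Matrix (Fin (m + 1)) (Fin (m + 1)) ℝ}
    (hQ : IsReversibleTransition p u Q) (i : Fin (m + 1)) :
    IsProbabilityMeasure (offspringLaw β κ p Q i) := by
  have h1 : 0 < 1 - κ := by linarith
  have := isProbabilityMeasure_typeChange hQ i
  have := isProbabilityMeasure_meixnerMeasure one_pos (by positivity : 0 ≤ κ / (1 - κ)) hp hp1
  refine ⟨?_⟩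
  rw [offspringLaw, Measure.add_apply, Measure.smul_apply, Measure.smul_apply, measure_univ,
    Measure.map_apply (measurable_of_countable _) MeasurableSet.univ, Set.preimage_univ,
    measure_univ, smul_eq_mul, smul_eq_mul, mul_one, mul_one,
    ← ENNReal.ofReal_add (by linarith) hβ0]
  simp

theorem integral_offspringLaw {β κ : ℝ} (hβ0 : 0 ≤ β) (hβ1 : β ≤ 1) (hκ0 : 0 ≤ κ)
    (hκ1 : κ < 1) {p : Fin (m + 1) → ℝ} (hp : ∀ i, 0 < p i) (hp1 : ∑ i, p i = 1)
    {u : Fin (m + 1) → Fin (m + 1) → ℝ} {Q : Matrix (Fin (m + 1)) (Fin (m + 1)) ℝ}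
    (hQ : IsReversibleTransition p u Q) (i : Fin (m + 1)) {t : Fin (m + 1) → ℝ}
    (ht : ∀ j, |t j| ≤ 1) :
    ∫ y, ∏ j, t j ^ y j ∂(offspringLaw β κ p Q i)
      = 1 - β + β * (1 - κ) * (∑ j, Q i j * t j) / (1 - κ * ∑ j, p j * t j) := by
  have h1 : 0 < 1 - κ := by linarith
  have := isProbabilityMeasure_typeChange hQ i
  have := isProbabilityMeasure_meixnerMeasure one_pos (by positivity : 0 ≤ κ / (1 - κ)) hp hp1
  have : IsProbabilityMeasure (((∑ j, ENNReal.ofReal (Q i j) •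
      Measure.dirac (Pi.single j 1 : Fin (m + 1) → ℕ)).prod
        (meixnerMeasure 1 (κ / (1 - κ)) p)).map (fun w => w.1 + w.2)) :=
    Measure.isProbabilityMeasure_map (measurable_of_countable _).aemeasurable
  rw [offspringLaw, integral_add_measure
    ((integrable_prod_pow _ ht).smul_measure (by simp))
    ((integrable_prod_pow _ ht).smul_measure (by simp)), integral_smul_measure,
    integral_smul_measure, integral_dirac, integral_prod_pow_map_add, integral_typeChange hQ,
    integral_meixnerMeasure one_pos hκ0 hκ1 hp hp1 ht, ENNReal.toReal_ofReal hβ0,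
    ENNReal.toReal_ofReal (by linarith)]
  simp only [Pi.zero_apply, pow_zero, prod_const_one, smul_eq_mul, Real.rpow_one]
  ring

theorem isProbabilityMeasure_bdiTransition {α β κ : ℝ} (hα : 0 < α) (hβ0 : 0 ≤ β) (hβ1 : β ≤ 1)
    (hκ0 : 0 ≤ κ) (hκ1 : κ < 1) {p : Fin (m + 1) → ℝ} (hp : ∀ i, 0 < p i) (hp1 : ∑ i, p i = 1)
    {u : Fin (m + 1) → Fin (m + 1) → ℝ} {Q : Matrix (Fin (m + 1)) (Fin (m + 1)) ℝ}
    (hQ : IsReversibleTransition p u Q) (x : Fin (m + 1) → ℕ) :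
    IsProbabilityMeasure (bdiTransition α β κ p Q x) := by
  have h1 : 0 < 1 - κ := by linarith
  have := isProbabilityMeasure_meixnerMeasure hα (by positivity : 0 ≤ κ / (1 - κ)) hp hp1
  have := isProbabilityMeasure_offspringLaw hβ0 hβ1 hκ0 hκ1 hp hp1 hQ
  exact Measure.isProbabilityMeasure_map (measurable_of_countable _).aemeasurable

theorem integral_bdiTransition {α β θ : ℝ} (hα : 0 < α) (hθ : 0 < θ) (hβ0 : 0 ≤ β) (hβ1 : β ≤ 1)
    {p : Fin (m + 1) → ℝ} (hp : ∀ i, 0 < p i) (hp1 : ∑ i, p i = 1)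
    {u : Fin (m + 1) → Fin (m + 1) → ℝ} {Q : Matrix (Fin (m + 1)) (Fin (m + 1)) ℝ}
    (hQ : IsReversibleTransition p u Q) (x : Fin (m + 1) → ℕ) {t : Fin (m + 1) → ℝ}
    (ht : ∀ j, |t j| ≤ 1) :
    ∫ y, ∏ j, t j ^ y j ∂(bdiTransition α β (kappa θ β) p Q x) = conditionalPgf α θ β p Q x t := by
  obtain ⟨hκ0, hκ1⟩ := kappa_mem hθ hβ0 hβ1
  rw [conditionalPgf, ← integral_meixnerMeasure hα hκ0 hκ1 hp hp1 ht]
  simp_rw [← integral_offspringLaw hβ0 hβ1 hκ0 hκ1 hp hp1 hQ _ ht]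
  set κ := kappa θ β
  have h1 : 0 < 1 - κ := by linarith
  have := isProbabilityMeasure_meixnerMeasure hα (by positivity : 0 ≤ κ / (1 - κ)) hp hp1
  have := isProbabilityMeasure_offspringLaw hβ0 hβ1 hκ0 hκ1 hp hp1 hQ
  rw [bdiTransition, integral_map (measurable_of_countable _).aemeasurable
    (measurable_of_countable _).aestronglyMeasurable]
  have h2 : ∀ w : (Fin (m + 1) → ℕ) × ((Σ i : Fin (m + 1), Fin (x i)) → Fin (m + 1) → ℕ),
      ∏ j, t j ^ (w.1 + ∑ k, w.2 k) j = (∏ j, t j ^ w.1 j) * ∏ k, ∏ j, t j ^ w.2 k j := by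
    intro w
    simp only [Pi.add_apply, Finset.sum_apply, pow_add, prod_mul_distrib, ← prod_pow_eq_pow_sum]
    rw [Finset.prod_comm]
  simp_rw [h2]
  rw [integral_prod_mul (fun y : Fin (m + 1) → ℕ => ∏ j, t j ^ y j)
    (fun w : (Σ i : Fin (m + 1), Fin (x i)) → Fin (m + 1) → ℕ => ∏ k, ∏ j, t j ^ w k j)]
  rw [integral_fintype_prod_eq_prod (fun (k : Σ i : Fin (m + 1), Fin (x i))
    (y : Fin (m + 1) → ℕ) => ∏ j, t j ^ y j), Fintype.prod_sigma]
  simp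

/-! ### Lancaster sequences and transition matrices -/

theorem conditionalPgf_congr_of_zero (α θ : ℝ) (p : Fin (m + 1) → ℝ)
    (Q Q' : Matrix (Fin (m + 1)) (Fin (m + 1)) ℝ) :
    conditionalPgf α θ 0 p Q = conditionalPgf α θ 0 p Q' := by
  ext x t
  simp [conditionalPgf]

theorem lancasterMass_eq_mul_bdiTransition {α θ : ℝ} (hα : 0 < α) (hθ : 0 < θ)
    {p : Fin (m + 1) → ℝ} (hp : ∀ i, 0 < p i) (hp1 : ∑ i, p i = 1)
    {u : Fin (m + 1) → Fin (m + 1) → ℝ} (hu : IsHypergroupBasis p u)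
    {ξ : Fin (m + 1) → ℝ} (hξ : ξ ∈ unitSimplex m) {Q : Matrix (Fin (m + 1)) (Fin (m + 1)) ℝ}
    (hQ : IsReversibleTransition p u Q) (h : ξ = 0 ∨ Q = transitionOf θ p u ξ)
    (x y : Fin (m + 1) → ℕ) :
    lancasterMass α θ p u (pointSequence u ξ) x y
      = meixnerMass α θ p x *
        (bdiTransition α (betaOf θ ξ) (kappa θ (betaOf θ ξ)) p Q x).real {y} := by
  obtain ⟨hβ0, hβ1⟩ := betaOf_mem hθ hξ
  obtain ⟨hκ0, hκ1⟩ := kappa_mem hθ hβ0 hβ1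
  have := isProbabilityMeasure_bdiTransition hα hβ0 hβ1 hκ0 hκ1 hp hp1 hQ x
  have hpgf : conditionalPgf α θ (betaOf θ ξ) p (transitionOf θ p u ξ)
      = conditionalPgf α θ (betaOf θ ξ) p Q := by
    rcases h with h | h
    · rw [h, betaOf_zero]
      exact conditionalPgf_congr_of_zero _ _ _ _ _
    · rw [h]
  refine congrFun (eq_of_hasSum_prod_pow (f := fun y =>
    lancasterMass α θ p u (pointSequence u ξ) x y)
    (g := fun y => meixnerMass α θ p x *
        (bdiTransition α (betaOf θ ξ) (kappa θ (betaOf θ ξ)) p Q x).real {y})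
    (hasSum_lancasterMass_mul_pow hα hθ hp hp1 hu hξ x) ?_) y
  filter_upwards [eventually_abs_lt_one] with t ht
  rw [hpgf, ← integral_bdiTransition hα hθ hβ0 hβ1 hp hp1 hQ x fun j => (ht j).le]
  refine ((hasSum_real_mul_prod_pow _ fun j => (ht j).le).mul_left _).congr_fun fun y => ?_
  ring

theorem isLancasterSequence_of_isReversibleTransition {θ : ℝ} (hθ : 0 < θ)
    {p : Fin (m + 1) → ℝ} (hp : ∀ i, 0 < p i) (hp1 : ∑ i, p i = 1)
    {u : Fin (m + 1) → Fin (m + 1) → ℝ} (hu : IsHypergroupBasis p u)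
    {ξ : Fin (m + 1) → ℝ} (hξ : ξ ∈ unitSimplex m) {Q : Matrix (Fin (m + 1)) (Fin (m + 1)) ℝ}
    (hQ : IsReversibleTransition p u Q) (h : ξ = 0 ∨ Q = transitionOf θ p u ξ) :
    IsLancasterSequence θ p u (pointSequence u ξ) := by
  intro α hα x y
  refine ⟨?_, ?_⟩
  · exact (summable_lancasterTerm hα hθ hp hu (abs_pointSequence_le hp hu hξ) x y).comp_injective
      Subtype.val_injective
  · rw [lancasterMass_eq_mul_bdiTransition hα hθ hp hp1 hu hξ hQ h]
    exact mul_nonneg (meixnerMass_nonneg hα hθ.le hp x) measureReal_nonneg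

theorem conditionalPgf_single (α θ β : ℝ) (p : Fin (m + 1) → ℝ)
    (Q : Matrix (Fin (m + 1)) (Fin (m + 1)) ℝ) (i j : Fin (m + 1)) (s : ℝ) :
    conditionalPgf α θ β p Q (Pi.single i 1) (Pi.single j s)
      = (1 - kappa θ β) ^ α / (1 - kappa θ β * (p j * s)) ^ α *
        (1 - β + β * (1 - kappa θ β) * (Q i j * s) / (1 - kappa θ β * (p j * s))) := by
  have h : ∀ f : Fin (m + 1) → ℝ, ∑ k, f k * (Pi.single j s : Fin (m + 1) → ℝ) k = f j * s := by
    intro f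
    rw [sum_eq_single j]
    · simp
    · intro k _ hk
      simp [hk]
    · simp
  rw [conditionalPgf]
  simp_rw [h]
  congr 1
  rw [prod_eq_single i]
  · simp
  · intro k _ hk
    simp [hk]
  · simp

theorem tendsto_single (j : Fin (m + 1)) :
    Tendsto (fun s : ℝ => (Pi.single j s : Fin (m + 1) → ℝ)) (𝓝[>] 0) (𝓝 0) := by
  have h : Continuous fun s : ℝ => (Pi.single j s : Fin (m + 1) → ℝ) :=
    continuous_single (A := fun _ => ℝ) j
  have := h.tendsto 0
  rw [Pi.single_zero] at this
  exact this.mono_left nhdsWithin_le_nhds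

theorem nonneg_of_hasDerivAt_of_eventually_le {f : ℝ → ℝ} {f' : ℝ} (hf : HasDerivAt f f' 0)
    (h : ∀ᶠ s in 𝓝[>] (0 : ℝ), f 0 ≤ f s) : 0 ≤ f' := by
  have h1 := (hasDerivAt_iff_tendsto_slope.mp hf).mono_left
    (nhdsWithin_mono _ fun s (hs : s ∈ Set.Ioi (0 : ℝ)) => (ne_of_gt hs : s ∈ ({0} : Set ℝ)ᶜ))
  refine ge_of_tendsto h1 ?_
  filter_upwards [h, self_mem_nhdsWithin] with s hs hs0
  rw [slope_def_field]
  exact div_nonneg (by linarith) (by simpa using le_of_lt hs0)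

theorem transitionOf_nonneg_of_isLancasterSequence {θ : ℝ} (hθ : 0 < θ)
    {p : Fin (m + 1) → ℝ} (hp : ∀ i, 0 < p i) (hp1 : ∑ i, p i = 1)
    {u : Fin (m + 1) → Fin (m + 1) → ℝ} (hu : IsHypergroupBasis p u)
    {ξ : Fin (m + 1) → ℝ} (hξ : ξ ∈ unitSimplex m) (h0 : ξ ≠ 0)
    (hL : IsLancasterSequence θ p u (pointSequence u ξ)) (i j : Fin (m + 1)) :
    0 ≤ transitionOf θ p u ξ i j := by
  obtain ⟨-, hβ1⟩ := betaOf_mem hθ hξ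
  have hβ0 := betaOf_pos hθ hξ h0
  obtain ⟨hκ0, hκ1⟩ := kappa_mem hθ hβ0.le hβ1
  set β := betaOf θ ξ with hβ
  set κ := kappa θ β with hκ
  set q := transitionOf θ p u ξ i j with hq
  have h1 : 0 < 1 - κ := by linarith
  have key : ∀ α : ℝ, 0 < α → 0 ≤ α * (κ * p j) * (1 - β) + β * (1 - κ) * q := by
    intro α hα
    have hd : HasDerivAt (fun s : ℝ => (1 - κ * (p j * s)) ^ (-α) *
        (1 - β + β * (1 - κ) * (q * s) / (1 - κ * (p j * s))))
        (α * (κ * p j) * (1 - β) + β * (1 - κ) * q) 0 := by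
      have d1 : HasDerivAt (fun s : ℝ => 1 - κ * (p j * s)) (-(κ * p j)) 0 := by
        have := (((hasDerivAt_id (0 : ℝ)).const_mul (p j)).const_mul κ).const_sub 1
        simpa using this
      have d2 := d1.rpow_const (p := -α) (Or.inl (by simp))
      have d3 : HasDerivAt (fun s : ℝ => β * (1 - κ) * (q * s)) (β * (1 - κ) * q) 0 := by
        have := ((hasDerivAt_id (0 : ℝ)).const_mul q).const_mul (β * (1 - κ))
        simpa using this
      have d4 := (d3.div d1 (by simp)).const_add (1 - β)
      have d5 := d2.mul d4
      convert! d5 using 1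
      simp only [mul_zero, sub_zero, Real.one_rpow, Pi.div_apply, add_zero, one_pow,
        div_one, mul_one, zero_mul]
      ring
    refine nonneg_of_hasDerivAt_of_eventually_le hd ?_
    have hev := hasSum_lancasterMass_mul_pow hα hθ hp hp1 hu hξ (Pi.single i 1)
    have hzero := hev.self_of_nhds
    have hpos : ∀ᶠ s in 𝓝[>] (0 : ℝ), 0 < 1 - κ * (p j * s) := by
      have hc : ContinuousAt (fun s : ℝ => 1 - κ * (p j * s)) 0 := by fun_prop
      exact (hc.eventually_const_lt (by simp)).filter_mono nhdsWithin_le_nhds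
    filter_upwards [(tendsto_single j).eventually hev, hpos, self_mem_nhdsWithin] with s hs hs1 hs0
    have hs0 : (0 : ℝ) < s := hs0
    have hle := hasSum_le (fun y => ?_) hzero hs
    · have hle := le_of_mul_le_mul_left hle (meixnerMass_pos hα hθ hp _)
      rw [← Pi.single_zero j, conditionalPgf_single, conditionalPgf_single, ← hβ, ← hκ, ← hq,
        div_eq_mul_inv, div_eq_mul_inv _ ((1 - κ * (p j * s)) ^ α), mul_assoc ((1 - κ) ^ α),
        mul_assoc ((1 - κ) ^ α)] at hle
      have hle := le_of_mul_le_mul_left hle (Real.rpow_pos_of_pos h1 α)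
      rwa [← Real.rpow_neg (by simp), ← Real.rpow_neg hs1.le] at hle
    · refine mul_le_mul_of_nonneg_left (prod_le_prod (fun k _ => by simp) fun k _ => ?_)
        (hL α hα _ _).2
      refine pow_le_pow_left₀ le_rfl ?_ _
      rw [Pi.single_apply]
      split_ifs
      exacts [hs0.le, le_rfl]
  by_contra hneg
  have hneg : q < 0 := not_le.mp hneg
  have hb : β * (1 - κ) * q < 0 := mul_neg_of_pos_of_neg (mul_pos hβ0 h1) hneg
  have hc : 0 ≤ κ * p j * (1 - β) := mul_nonneg (mul_nonneg hκ0 (hp j).le) (by linarith)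
  have := key (-(β * (1 - κ) * q) / (2 * (κ * p j * (1 - β) + 1)))
    (div_pos (by linarith) (by linarith))
  have h2 : -(β * (1 - κ) * q) / (2 * (κ * p j * (1 - β) + 1)) * (κ * p j) * (1 - β)
      ≤ -(β * (1 - κ) * q) / 2 := by
    rw [mul_assoc, div_mul_eq_mul_div, div_le_div_iff₀ (by linarith) two_pos]
    nlinarith
  linarith

theorem isReversibleTransition_one (p : Fin (m + 1) → ℝ) (u : Fin (m + 1) → Fin (m + 1) → ℝ) :
    IsReversibleTransition p u 1 where
  nonneg i j := by rw [Matrix.one_apply]; split_ifs <;> norm_num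
  row_sum i := by simp [Matrix.one_apply]
  reversible i j := by
    rcases eq_or_ne i j with rfl | h
    · rfl
    · simp [h, h.symm]
  eigenvector r := ⟨1, by simp⟩

/-- A transition matrix with the eigenvectors `u r` is determined by its last row. -/
theorem sum_last_row_mul_tripleSum {p : Fin (m + 1) → ℝ} (hp : ∀ i, 0 < p i)
    {u : Fin (m + 1) → Fin (m + 1) → ℝ} (hu : IsHypergroupBasis p u)
    {Q : Matrix (Fin (m + 1)) (Fin (m + 1)) ℝ} (hQ : IsReversibleTransition p u Q)
    (i j : Fin (m + 1)) : p j * ∑ l, Q (Fin.last m) l * tripleSum p u i j l = Q i j := by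
  have hc : ∀ r, (∑ l, Q (Fin.last m) l * u r l) * u r i = ∑ k, Q i k * u r k := by
    intro r
    obtain ⟨c, hc⟩ := hQ.eigenvector r
    have h1 := congrFun hc (Fin.last m)
    have h2 := congrFun hc i
    simp only [Pi.smul_apply, smul_eq_mul, hu.last_eq_one, mul_one] at h1 h2
    change ∑ l, Q (Fin.last m) l * u r l = c at h1
    change ∑ l, Q i l * u r l = _ at h2
    rw [h1, h2]
  have e1 : ∑ l, Q (Fin.last m) l * tripleSum p u i j l
      = ∑ k, Q i k * ∑ r, (sqNorm p u r)⁻¹ * u r j * u r k := by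
    simp only [tripleSum, mul_sum]
    rw [Finset.sum_comm, Finset.sum_comm (s := univ) (t := univ) (f := fun k r =>
      Q i k * ((sqNorm p u r)⁻¹ * u r j * u r k))]
    refine sum_congr rfl fun r _ => ?_
    calc _ = (sqNorm p u r)⁻¹ * u r j * ((∑ l, Q (Fin.last m) l * u r l) * u r i) := by
          rw [sum_mul, mul_sum]; exact sum_congr rfl fun _ _ => by ring
      _ = _ := by rw [hc, mul_sum]; exact sum_congr rfl fun _ _ => by ring
  rw [e1, mul_sum]
  simp_rw [mul_left_comm (p j), sum_sqNorm_inv_mul hp hu]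
  simp

theorem tripleSum_comm_right (p : Fin (m + 1) → ℝ) (u : Fin (m + 1) → Fin (m + 1) → ℝ)
    (i j l : Fin (m + 1)) : tripleSum p u i j l = tripleSum p u i l j :=
  sum_congr rfl fun _ _ => by ring

/-- Every admissible `(β, Q)` with `β > 0` comes from a point of the simplex. -/
theorem exists_of_isReversibleTransition {θ : ℝ} (hθ : 0 < θ)
    {p : Fin (m + 1) → ℝ} (hp : ∀ i, 0 < p i) (hp1 : ∑ i, p i = 1)
    {u : Fin (m + 1) → Fin (m + 1) → ℝ} (hu : IsHypergroupBasis p u)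
    {β : ℝ} (hβ0 : 0 < β) (hβ1 : β ≤ 1) {Q : Matrix (Fin (m + 1)) (Fin (m + 1)) ℝ}
    (hQ : IsReversibleTransition p u Q) :
    ∃ ξ ∈ unitSimplex m, ξ ≠ 0 ∧ betaOf θ ξ = β ∧ transitionOf θ p u ξ = Q := by
  obtain ⟨hκ0, hκ1⟩ := kappa_mem hθ hβ0.le hβ1
  set κ := kappa θ β with hκ
  set ρ := β * (1 + θ) / (1 + β * θ) with hρ
  have hρ0 : 0 < ρ := by positivity
  have hρ1 : ρ ≤ 1 := by
    rw [hρ, div_le_one (by positivity)]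
    nlinarith
  set ω : Fin (m + 1) → ℝ := fun l => κ * p l + (1 - κ) * Q (Fin.last m) l with hω
  have hω0 : ∀ l, 0 ≤ ω l := fun l =>
    add_nonneg (mul_nonneg hκ0 (hp l).le) (mul_nonneg (by linarith) (hQ.nonneg _ _))
  have hω1 : ∑ l, ω l = 1 := by
    simp only [hω]
    rw [sum_add_distrib, ← mul_sum, ← mul_sum, hp1, hQ.row_sum]
    ring
  have hsum : ∑ l, ρ * ω l = ρ := by rw [← mul_sum, hω1, mul_one]
  have hβ : betaOf θ (fun l => ρ * ω l) = β := by
    have h1 : 0 < 1 + θ * (1 - ρ) := by nlinarith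
    rw [betaOf, hsum, div_eq_iff h1.ne', hρ]
    field_simp
    ring
  refine ⟨fun l => ρ * ω l, ⟨fun l => mul_nonneg hρ0.le (hω0 l), by rw [hsum]; exact hρ1⟩,
    ?_, hβ, ?_⟩
  · intro h
    rw [h] at hβ
    rw [betaOf_zero] at hβ
    exact hβ0.ne hβ
  · ext i j
    rw [transitionOf, hβ, hsum, ← hκ, div_eq_iff (by linarith)]
    have e1 : ∑ l, ρ * ω l / ρ * tripleSum p u i j l
        = κ * (∑ l, p l * tripleSum p u i l j)
          + (1 - κ) * ∑ l, Q (Fin.last m) l * tripleSum p u i j l := by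
      rw [mul_sum, mul_sum, ← sum_add_distrib]
      refine sum_congr rfl fun l _ => ?_
      rw [mul_div_cancel_left₀ _ hρ0.ne', tripleSum_comm_right p u i l j]
      ring
    rw [e1, sum_mul_tripleSum hp hu]
    linear_combination (1 - κ) * sum_last_row_mul_tripleSum hp hu hQ i j

theorem injOn_betaOf_transitionOf {θ : ℝ} (hθ : 0 < θ)
    {p : Fin (m + 1) → ℝ} (hp : ∀ i, 0 < p i)
    {u : Fin (m + 1) → Fin (m + 1) → ℝ} (hu : IsHypergroupBasis p u)
    {ξ η : Fin (m + 1) → ℝ} (hξ : ξ ∈ unitSimplex m) (hη : η ∈ unitSimplex m)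
    (hβ : betaOf θ ξ = betaOf θ η) (hQ : transitionOf θ p u ξ = transitionOf θ p u η) : ξ = η := by
  have hs : ∑ i, ξ i = ∑ i, η i := by
    have h1 := one_add_mul_one_sub_pos hθ hξ
    have h2 := one_add_mul_one_sub_pos hθ hη
    rw [betaOf, betaOf, div_eq_div_iff h1.ne' h2.ne'] at hβ
    have : (∑ i, ξ i - ∑ i, η i) * (1 + θ) = 0 := by linear_combination hβ
    have h3 := (mul_eq_zero.mp this).resolve_right (by positivity)
    linarith
  have key : ∀ ζ ∈ unitSimplex m, ∀ j, ζ j = (∑ k, ζ k) * ((1 - kappa θ (betaOf θ ζ))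
      * transitionOf θ p u ζ (Fin.last m) j) + kappa θ (betaOf θ ζ) * (∑ k, ζ k) * p j := by
    intro ζ hζ j
    rw [mul_transitionOf hθ p u hζ, sub_add_cancel, mul_sum]
    simp_rw [mul_left_comm (p j), tripleSum_last hp hu]
    simp
  ext j
  rw [key ξ hξ j, key η hη j, hs, hβ, hQ]

theorem eq_of_lancasterMass_eq {θ : ℝ} (hθ : 0 < θ)
    {p : Fin (m + 1) → ℝ} (hp : ∀ i, 0 < p i) (hp1 : ∑ i, p i = 1)
    {u : Fin (m + 1) → Fin (m + 1) → ℝ} (hu : IsHypergroupBasis p u)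
    {ξ : Fin (m + 1) → ℝ} (hξ : ξ ∈ unitSimplex m) {β : ℝ} (hβ0 : 0 ≤ β) (hβ1 : β ≤ 1)
    {Q : Matrix (Fin (m + 1)) (Fin (m + 1)) ℝ} (hQ : IsReversibleTransition p u Q)
    (h : ∀ x y : Fin (m + 1) → ℕ, lancasterMass 1 θ p u (pointSequence u ξ) x y
      = meixnerMass 1 θ p x * (bdiTransition 1 β (kappa θ β) p Q x).real {y}) :
    β = betaOf θ ξ ∧ (ξ = 0 ∨ Q = transitionOf θ p u ξ) := by
  obtain ⟨hκ0, hκ1⟩ := kappa_mem hθ hβ0 hβ1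
  have hpgf : ∀ x, ∀ᶠ t in 𝓝 (0 : Fin (m + 1) → ℝ),
      conditionalPgf 1 θ β p Q x t
        = conditionalPgf 1 θ (betaOf θ ξ) p (transitionOf θ p u ξ) x t := by
    intro x
    have := isProbabilityMeasure_bdiTransition one_pos hβ0 hβ1 hκ0 hκ1 hp hp1 hQ x
    filter_upwards [hasSum_lancasterMass_mul_pow one_pos hθ hp hp1 hu hξ x,
      eventually_abs_lt_one] with t h1 ht
    have h2 := (hasSum_real_mul_prod_pow (bdiTransition 1 β (kappa θ β) p Q x)
      fun j => (ht j).le).mul_left (meixnerMass 1 θ p x)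
    rw [integral_bdiTransition one_pos hθ hβ0 hβ1 hp hp1 hQ x fun j => (ht j).le] at h2
    simp_rw [h, mul_assoc] at h1
    exact mul_left_cancel₀ (meixnerMass_pos one_pos hθ hp x).ne' (h2.unique h1)
  have hβ : β = betaOf θ ξ := by
    have := (hpgf 0).self_of_nhds
    simp only [conditionalPgf, Real.rpow_one, Pi.zero_apply, mul_zero, sum_const_zero, sub_zero,
      div_one, pow_zero, prod_const_one, mul_one, kappa] at this
    have h1 : (1 + θ) ≠ 0 := by positivity
    field_simp at this
    have h2 : (β - betaOf θ ξ) * θ = 0 := by linear_combination this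
    exact sub_eq_zero.mp ((mul_eq_zero.mp h2).resolve_right hθ.ne')
  refine ⟨hβ, ?_⟩
  rw [or_iff_not_imp_left]
  intro h0
  have hβpos := betaOf_pos hθ hξ h0
  rw [← hβ] at hpgf hβpos
  ext i j
  have hev := (tendsto_single j).eventually (hpgf (Pi.single i 1))
  have hpos : ∀ᶠ s in 𝓝[>] (0 : ℝ), 0 < 1 - kappa θ β * (p j * s) := by
    have hc : ContinuousAt (fun s : ℝ => 1 - kappa θ β * (p j * s)) 0 := by fun_prop
    exact (hc.eventually_const_lt (by simp)).filter_mono nhdsWithin_le_nhds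
  obtain ⟨s, ⟨hs, hs1⟩, hs0⟩ := ((hev.and hpos).and self_mem_nhdsWithin).exists
  have hs0 : (0 : ℝ) < s := hs0
  have hk : 0 < 1 - kappa θ β := by linarith
  rw [conditionalPgf_single, conditionalPgf_single, Real.rpow_one, Real.rpow_one] at hs
  have h3 := mul_left_cancel₀ (div_pos hk hs1).ne' hs
  have h4 := add_left_cancel h3
  rw [div_left_inj' hs1.ne'] at h4
  have h5 := mul_left_cancel₀ (mul_pos hβpos hk).ne' h4
  exact mul_right_cancel₀ hs0.ne' h5

/-! ### Joint laws -/

theorem joint_eq_mul_iff {Ω : Type*} [MeasurableSpace Ω] (P : Measure Ω) [IsProbabilityMeasure P]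
    {A : Set Ω} (hA : MeasurableSet A) {Y : Ω → Fin (m + 1) → ℕ} (hY : Measurable Y) {c : ℝ}
    (hc : 0 < c) (ν : Measure (Fin (m + 1) → ℕ)) [IsProbabilityMeasure ν] :
    (∀ y, P.real (A ∩ Y ⁻¹' {y}) = c * ν.real {y}) ↔
      P.real A = c ∧ (ProbabilityTheory.cond P A).map Y = ν := by
  have hcond : ∀ y, ((ProbabilityTheory.cond P A).map Y).real {y}
      = (P.real A)⁻¹ * P.real (A ∩ Y ⁻¹' {y}) := by
    intro y
    rw [map_measureReal_apply hY (measurableSet_singleton y), measureReal_def,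
      ProbabilityTheory.cond_apply hA,
      ENNReal.toReal_mul, ENNReal.toReal_inv]
    rfl
  have htot : ∀ μ : Measure (Fin (m + 1) → ℕ), IsFiniteMeasure μ →
      HasSum (fun y => μ.real {y}) (μ.real Set.univ) := by
    intro μ _
    simpa using hasSum_real_mul_prod_pow μ (t := fun _ => 1) (by simp)
  constructor
  · intro h
    have h1 : P.real A = c := by
      have h2 := htot ((P.restrict A).map Y) inferInstance
      have h3 := (htot ν inferInstance).mul_left c
      simp only [probReal_univ, mul_one] at h3
      have h4 : ∀ y, ((P.restrict A).map Y).real {y} = c * ν.real {y} := by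
        intro y
        rw [map_measureReal_apply hY (measurableSet_singleton y),
          measureReal_restrict_apply (hY (measurableSet_singleton y)), Set.inter_comm]
        exact h y
      simp_rw [h4] at h2
      rw [map_measureReal_apply hY MeasurableSet.univ, Set.preimage_univ,
        measureReal_restrict_apply MeasurableSet.univ, Set.univ_inter] at h2
      exact h2.unique h3
    refine ⟨h1, Measure.ext_of_singleton fun y => ?_⟩
    have h2 := hcond y
    rw [h, h1, inv_mul_cancel_left₀ hc.ne', measureReal_def, measureReal_def] at h2
    rwa [ENNReal.toReal_eq_toReal_iff' (measure_ne_top _ _) (measure_ne_top _ _)] at h2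
  · rintro ⟨h1, h2⟩ y
    have h3 := hcond y
    rw [h2, h1] at h3
    rw [h3, mul_inv_cancel_left₀ hc.ne']

/-! ### Extreme points -/

theorem continuous_pointSequence (u : Fin (m + 1) → Fin (m + 1) → ℝ) (n : Fin (m + 1) →₀ ℕ) :
    Continuous fun ξ => pointSequence u ξ n := by
  unfold pointSequence
  fun_prop

theorem integrable_pointSequence {p : Fin (m + 1) → ℝ} (hp : ∀ i, 0 < p i)
    {u : Fin (m + 1) → Fin (m + 1) → ℝ} (hu : IsHypergroupBasis p u)
    {μ : Measure (Fin (m + 1) → ℝ)} [IsFiniteMeasure μ] (hμ : ∀ᵐ ξ ∂μ, ξ ∈ unitSimplex m)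
    (n : Fin (m + 1) →₀ ℕ) : Integrable (fun ξ => pointSequence u ξ n) μ :=
  Integrable.of_bound (continuous_pointSequence u n).aestronglyMeasurable 1
    (hμ.mono fun _ hξ => abs_pointSequence_le hp hu hξ n)

theorem pointSequence_mem {u : Fin (m + 1) → Fin (m + 1) → ℝ} {ξ : Fin (m + 1) → ℝ}
    (hξ : ξ ∈ unitSimplex m) : pointSequence u ξ ∈ momentSequences u :=
  ⟨Measure.dirac ξ, inferInstance, by rw [ae_dirac_eq]; exact hξ, fun n => by
    rw [integral_dirac]⟩

theorem pointSequence_single (u : Fin (m + 1) → Fin (m + 1) → ℝ) (ξ : Fin (m + 1) → ℝ)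
    (j : Fin (m + 1)) (k : ℕ) :
    pointSequence u ξ (Finsupp.single j k) = (∑ i, u j i * ξ i) ^ k := by
  rw [pointSequence, prod_eq_single j]
  · simp
  · intro i _ hi
    simp [hi.symm]
  · simp

theorem pointSequence_injective {p : Fin (m + 1) → ℝ} (hp : ∀ i, 0 < p i)
    {u : Fin (m + 1) → Fin (m + 1) → ℝ} (hu : IsHypergroupBasis p u) :
    Function.Injective (pointSequence u) := by
  intro ξ η h
  have key : ∀ ζ : Fin (m + 1) → ℝ, ∀ j,
      ζ j = p j * ∑ r, (sqNorm p u r)⁻¹ * u r j * (∑ i, u r i * ζ i) := by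
    intro ζ j
    have e1 : ∑ r, (sqNorm p u r)⁻¹ * u r j * (∑ i, u r i * ζ i)
        = ∑ i, ζ i * ∑ r, (sqNorm p u r)⁻¹ * u r j * u r i := by
      simp_rw [mul_sum]
      rw [Finset.sum_comm]
      exact sum_congr rfl fun i _ => sum_congr rfl fun r _ => by ring
    rw [e1, mul_sum]
    simp_rw [mul_left_comm (p j), sum_sqNorm_inv_mul hp hu]
    simp
  ext j
  rw [key ξ j, key η j]
  have h1 : ∀ r, ∑ i, u r i * ξ i = ∑ i, u r i * η i := by
    intro r
    have := congrFun h (Finsupp.single r 1)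
    simpa only [pointSequence_single, pow_one] using this
  simp_rw [h1]

/-- The variance functional `ρ ↦ E (ρ_j - c)²`. -/
theorem integral_sub_sq {p : Fin (m + 1) → ℝ} (hp : ∀ i, 0 < p i)
    {u : Fin (m + 1) → Fin (m + 1) → ℝ} (hu : IsHypergroupBasis p u)
    {μ : Measure (Fin (m + 1) → ℝ)} [IsProbabilityMeasure μ] (hμ : ∀ᵐ ξ ∂μ, ξ ∈ unitSimplex m)
    (j : Fin (m + 1)) (c : ℝ) :
    Integrable (fun ξ => ((∑ i, u j i * ξ i) - c) ^ 2) μ ∧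
    ∫ ξ, ((∑ i, u j i * ξ i) - c) ^ 2 ∂μ
      = ∫ ξ, pointSequence u ξ (Finsupp.single j 2) ∂μ
        - 2 * c * ∫ ξ, pointSequence u ξ (Finsupp.single j 1) ∂μ + c ^ 2 := by
  have h1 := integrable_pointSequence hp hu hμ (Finsupp.single j 1)
  have h2 := integrable_pointSequence hp hu hμ (Finsupp.single j 2)
  have he : (fun ξ : Fin (m + 1) → ℝ => ((∑ i, u j i * ξ i) - c) ^ 2)
      = fun ξ => pointSequence u ξ (Finsupp.single j 2)
        - 2 * c * pointSequence u ξ (Finsupp.single j 1) + c ^ 2 := by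
    ext ξ
    rw [pointSequence_single, pointSequence_single]
    ring
  rw [he]
  have h3 : Integrable (fun ξ => pointSequence u ξ (Finsupp.single j 2)
      - 2 * c * pointSequence u ξ (Finsupp.single j 1)) μ := h2.sub (h1.const_mul _)
  refine ⟨h3.add (integrable_const _), ?_⟩
  rw [integral_add h3 (integrable_const _),
    integral_sub h2 (h1.const_mul _), integral_const_mul, integral_const]
  simp

theorem pointSequence_mem_extremePoints {p : Fin (m + 1) → ℝ} (hp : ∀ i, 0 < p i)
    {u : Fin (m + 1) → Fin (m + 1) → ℝ} (hu : IsHypergroupBasis p u) {ξ : Fin (m + 1) → ℝ}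
    (hξ : ξ ∈ unitSimplex m) :
    pointSequence u ξ ∈ Set.extremePoints ℝ (momentSequences u) := by
  refine ⟨pointSequence_mem hξ, ?_⟩
  rintro ρ₁ ⟨μ₁, hp₁, hS₁, h₁⟩ ρ₂ ⟨μ₂, hp₂, hS₂, h₂⟩ ⟨a, b, ha, hb, hab, h⟩
  have hpt : ∀ n, a * ρ₁ n + b * ρ₂ n = pointSequence u ξ n := fun n => congrFun h n
  have hae : ∀ j, ∀ᵐ η ∂μ₁, ∑ i, u j i * η i = ∑ i, u j i * ξ i := by
    intro j
    set c := ∑ i, u j i * ξ i with hc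
    obtain ⟨i1, e1⟩ := integral_sub_sq hp hu hS₁ j c
    obtain ⟨i2, e2⟩ := integral_sub_sq hp hu hS₂ j c
    rw [← h₁, ← h₁] at e1
    rw [← h₂, ← h₂] at e2
    have q1 := hpt (Finsupp.single j 1)
    have q2 := hpt (Finsupp.single j 2)
    rw [pointSequence_single, ← hc] at q1 q2
    have n1 : 0 ≤ ∫ η, ((∑ i, u j i * η i) - c) ^ 2 ∂μ₁ := integral_nonneg fun _ => sq_nonneg _
    have n2 : 0 ≤ ∫ η, ((∑ i, u j i * η i) - c) ^ 2 ∂μ₂ := integral_nonneg fun _ => sq_nonneg _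
    have hz : a * (∫ η, ((∑ i, u j i * η i) - c) ^ 2 ∂μ₁)
        + b * (∫ η, ((∑ i, u j i * η i) - c) ^ 2 ∂μ₂) = 0 := by
      rw [e1, e2]
      linear_combination q2 - 2 * c * q1 + c ^ 2 * hab
    have hz1 : ∫ η, ((∑ i, u j i * η i) - c) ^ 2 ∂μ₁ = 0 := by
      have hb2 := mul_nonneg hb.le n2
      have ha1 := mul_nonneg ha.le n1
      exact (mul_eq_zero.mp (by linarith)).resolve_left ha.ne'
    rw [integral_eq_zero_iff_of_nonneg (fun _ => sq_nonneg _) i1] at hz1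
    filter_upwards [hz1] with η hη
    have := pow_eq_zero_iff two_ne_zero |>.mp hη
    linarith
  ext n
  rw [h₁]
  have : ∀ᵐ η ∂μ₁, pointSequence u η n = pointSequence u ξ n := by
    filter_upwards [ae_all_iff.mpr hae] with η hη
    simp only [pointSequence, hη]
  rw [integral_congr_ae this]
  simp

theorem exists_pointSequence_eq_of_mem_extremePoints {p : Fin (m + 1) → ℝ} (hp : ∀ i, 0 < p i)
    {u : Fin (m + 1) → Fin (m + 1) → ℝ} (hu : IsHypergroupBasis p u)
    {ρ : (Fin (m + 1) →₀ ℕ) → ℝ} (hρ : ρ ∈ Set.extremePoints ℝ (momentSequences u)) :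
    ∃ ξ ∈ unitSimplex m, pointSequence u ξ = ρ := by
  obtain ⟨⟨μ, hμ, hS, h⟩, hext⟩ := hρ
  have hcond : ∀ A : Set (Fin (m + 1) → ℝ), MeasurableSet A → μ A ≠ 0 →
      (fun n => ∫ ξ, pointSequence u ξ n ∂(ProbabilityTheory.cond μ A)) ∈ momentSequences u := by
    intro A hA h0
    exact ⟨ProbabilityTheory.cond μ A, ProbabilityTheory.cond_isProbabilityMeasure h0,
      ProbabilityTheory.cond_absolutelyContinuous.ae_le hS, fun n => rfl⟩
  have hint : ∀ (A : Set (Fin (m + 1) → ℝ)) n, μ A ≠ 0 → ∫ ξ in A, pointSequence u ξ n ∂μ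
      = μ.real A * ∫ ξ, pointSequence u ξ n ∂(ProbabilityTheory.cond μ A) := by
    intro A n h0
    rw [ProbabilityTheory.cond, integral_smul_measure, ENNReal.toReal_inv, smul_eq_mul,
      measureReal_def, mul_inv_cancel_left₀]
    exact ENNReal.toReal_ne_zero.mpr ⟨h0, measure_ne_top _ _⟩
  have key : ∀ A : Set (Fin (m + 1) → ℝ), MeasurableSet A → ∀ n,
      ∫ ξ in A, pointSequence u ξ n ∂μ = μ.real A * ρ n := by
    intro A hA n
    by_cases h0 : μ A = 0
    · rw [Measure.restrict_eq_zero.mpr h0, integral_zero_measure, measureReal_def, h0]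
      simp
    by_cases h1 : μ Aᶜ = 0
    · rw [Measure.restrict_eq_self_of_ae_mem (by rwa [ae_iff]), ← h,
        measureReal_def, (prob_compl_eq_zero_iff hA).mp h1]
      simp
    have := hext (hcond A hA h0) (hcond Aᶜ hA.compl h1)
      ⟨μ.real A, μ.real Aᶜ, ENNReal.toReal_pos h0 (measure_ne_top _ _),
        ENNReal.toReal_pos h1 (measure_ne_top _ _), ?_, ?_⟩
    · rw [hint A n h0]
      rw [← this]
    · rw [probReal_compl_eq_one_sub hA]
      ring
    · ext k
      simp only [Pi.add_apply, Pi.smul_apply, smul_eq_mul]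
      rw [← hint A k h0, ← hint Aᶜ k h1, h,
        integral_add_compl hA (integrable_pointSequence hp hu hS k)]
  have hae : ∀ n, ∀ᵐ ξ ∂μ, pointSequence u ξ n = ρ n := by
    intro n
    refine Integrable.ae_eq_of_forall_setIntegral_eq _ (fun _ => ρ n)
      (integrable_pointSequence hp hu hS n) (integrable_const _) fun A hA _ => ?_
    rw [key A hA, setIntegral_const, smul_eq_mul]
  obtain ⟨ξ, hξ, hξρ⟩ := (hS.and (ae_all_iff.mpr hae)).exists
  exact ⟨ξ, hξ, funext hξρ⟩

theorem bijOn_pointSequence {p : Fin (m + 1) → ℝ} (hp : ∀ i, 0 < p i)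
    {u : Fin (m + 1) → Fin (m + 1) → ℝ} (hu : IsHypergroupBasis p u) :
    Set.BijOn (pointSequence u) (unitSimplex m) (Set.extremePoints ℝ (momentSequences u)) :=
  ⟨fun _ hξ => pointSequence_mem_extremePoints hp hu hξ, (pointSequence_injective hp hu).injOn,
    fun _ hρ => exists_pointSequence_eq_of_mem_extremePoints hp hu hρ⟩

/-! ### The main statements -/

theorem joint_eq_lancasterMass_iff {α θ : ℝ} (hα : 0 < α) (hθ : 0 < θ)
    {p : Fin (m + 1) → ℝ} (hp : ∀ i, 0 < p i) (hp1 : ∑ i, p i = 1)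
    {u : Fin (m + 1) → Fin (m + 1) → ℝ} (hu : IsHypergroupBasis p u)
    {ξ : Fin (m + 1) → ℝ} (hξ : ξ ∈ unitSimplex m) {Q : Matrix (Fin (m + 1)) (Fin (m + 1)) ℝ}
    (hQ : IsReversibleTransition p u Q) (h : ξ = 0 ∨ Q = transitionOf θ p u ξ)
    {Ω : Type*} [MeasurableSpace Ω] (P : Measure Ω) [IsProbabilityMeasure P]
    {X Y : Ω → Fin (m + 1) → ℕ} (hX : Measurable X) (hY : Measurable Y) :
    (∀ x y, P.real (X ⁻¹' {x} ∩ Y ⁻¹' {y})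
        = lancasterMass α θ p u (pointSequence u ξ) x y) ↔
      (∀ x, P.real (X ⁻¹' {x}) = meixnerMass α θ p x) ∧
        ∀ (x : Fin (m + 1) → ℕ) (t : Fin (m + 1) → ℝ), (∀ j, t j ∈ Set.Icc (-1 : ℝ) 1) →
          ∫ ω, ∏ j, t j ^ Y ω j ∂(ProbabilityTheory.cond P (X ⁻¹' {x}))
            = conditionalPgf α θ (betaOf θ ξ) p Q x t := by
  obtain ⟨hβ0, hβ1⟩ := betaOf_mem hθ hξ
  obtain ⟨hκ0, hκ1⟩ := kappa_mem hθ hβ0 hβ1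
  have hprob := fun x => isProbabilityMeasure_bdiTransition hα hβ0 hβ1 hκ0 hκ1 hp hp1 hQ x
  have hX1 : ∀ x, MeasurableSet (X ⁻¹' {x}) := fun x => hX (measurableSet_singleton x)
  have hmap : ∀ x (t : Fin (m + 1) → ℝ),
      ∫ y, ∏ j, t j ^ y j ∂((ProbabilityTheory.cond P (X ⁻¹' {x})).map Y)
        = ∫ ω, ∏ j, t j ^ Y ω j ∂(ProbabilityTheory.cond P (X ⁻¹' {x})) := fun x t =>
    integral_map hY.aemeasurable (measurable_of_countable _).aestronglyMeasurable
  simp_rw [lancasterMass_eq_mul_bdiTransition hα hθ hp hp1 hu hξ hQ h]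
  rw [← forall_and]
  refine forall_congr' fun x => ?_
  rw [joint_eq_mul_iff P (hX1 x) hY (meixnerMass_pos hα hθ hp x)]
  refine and_congr_right fun hx => ⟨fun heq t ht => ?_, fun hpgf => ?_⟩
  · rw [← hmap, heq]
    exact integral_bdiTransition hα hθ hβ0 hβ1 hp hp1 hQ x fun j => abs_le.mpr (ht j)
  · have h0 : P (X ⁻¹' {x}) ≠ 0 := by
      intro h0
      rw [measureReal_def, h0, ENNReal.toReal_zero] at hx
      exact (meixnerMass_pos hα hθ hp x).ne hx
    have := ProbabilityTheory.cond_isProbabilityMeasure h0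
    have := Measure.isProbabilityMeasure_map
      (μ := ProbabilityTheory.cond P (X ⁻¹' {x})) hY.aemeasurable
    refine measure_ext_of_integral_prod_pow fun t ht => ?_
    rw [hmap, hpgf t fun j => abs_le.mp (ht j),
      integral_bdiTransition hα hθ hβ0 hβ1 hp hp1 hQ x ht]

theorem exists_admissible_of_isLancasterSequence {θ : ℝ} (hθ : 0 < θ)
    {p : Fin (m + 1) → ℝ} (hp : ∀ i, 0 < p i) (hp1 : ∑ i, p i = 1)
    {u : Fin (m + 1) → Fin (m + 1) → ℝ} (hu : IsHypergroupBasis p u)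
    {ξ : Fin (m + 1) → ℝ} (hξ : ξ ∈ unitSimplex m)
    (hL : IsLancasterSequence θ p u (pointSequence u ξ)) :
    ∃ Q, IsReversibleTransition p u Q ∧ (ξ = 0 ∨ Q = transitionOf θ p u ξ) := by
  by_cases h0 : ξ = 0
  · exact ⟨1, isReversibleTransition_one p u, Or.inl h0⟩
  · exact ⟨_, isReversibleTransition_transitionOf hθ hp hp1 hu hξ h0
      (transitionOf_nonneg_of_isLancasterSequence hθ hp hp1 hu hξ h0 hL), Or.inr rfl⟩

theorem exists_point_of_admissible {θ : ℝ} (hθ : 0 < θ)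
    {p : Fin (m + 1) → ℝ} (hp : ∀ i, 0 < p i) (hp1 : ∑ i, p i = 1)
    {u : Fin (m + 1) → Fin (m + 1) → ℝ} (hu : IsHypergroupBasis p u)
    {β : ℝ} (hβ0 : 0 ≤ β) (hβ1 : β ≤ 1) {Q : Matrix (Fin (m + 1)) (Fin (m + 1)) ℝ}
    (hQ : IsReversibleTransition p u Q) :
    ∃ ξ ∈ unitSimplex m, betaOf θ ξ = β ∧ (ξ = 0 ∨ Q = transitionOf θ p u ξ) := by
  rcases hβ0.eq_or_lt with h | h
  · exact ⟨0, ⟨fun _ => le_rfl, by simp⟩, by rw [betaOf_zero, h], Or.inl rfl⟩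
  · obtain ⟨ξ, hξ, -, h1, h2⟩ := exists_of_isReversibleTransition hθ hp hp1 hu h hβ1 hQ
    exact ⟨ξ, hξ, h1, Or.inr h2.symm⟩

end MeixnerLancaster

end

theorem mainTheorem4 {m : ℕ} (θ : ℝ) (hθ : 0 < θ)
    (p : Fin (m + 1) → ℝ) (hp : ∀ i, 0 < p i) (hp1 : ∑ i, p i = 1)
    (u : Fin (m + 1) → Fin (m + 1) → ℝ) (hu : MeixnerLancaster.IsHypergroupBasis p u) :
    -- the extreme points are the sequences that come from a non-random `ξ`
    Set.BijOn (MeixnerLancaster.pointSequence u) (MeixnerLancaster.unitSimplex m)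
      (Set.extremePoints ℝ (MeixnerLancaster.momentSequences u)) ∧
    -- Lancaster expansion at an extreme point iff the conditional pgf has the explicit form
    (∀ α : ℝ, 0 < α → ∀ (Ω : Type*) [MeasurableSpace Ω] (P : MeasureTheory.Measure Ω)
      [MeasureTheory.IsProbabilityMeasure P] (X Y : Ω → Fin (m + 1) → ℕ),
      Measurable X → Measurable Y →
      ((∃ ρ ∈ Set.extremePoints ℝ (MeixnerLancaster.momentSequences u),
          MeixnerLancaster.IsLancasterSequence θ p u ρ ∧
          ∀ x y, P.real (X ⁻¹' {x} ∩ Y ⁻¹' {y}) = MeixnerLancaster.lancasterMass α θ p u ρ x y) ↔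
        ∃ (β : ℝ) (Q : Matrix (Fin (m + 1)) (Fin (m + 1)) ℝ),
          0 ≤ β ∧ β ≤ 1 ∧ MeixnerLancaster.IsReversibleTransition p u Q ∧
          (∀ x, P.real (X ⁻¹' {x}) = MeixnerLancaster.meixnerMass α θ p x) ∧
          ∀ (x : Fin (m + 1) → ℕ) (t : Fin (m + 1) → ℝ), (∀ j, t j ∈ Set.Icc (-1 : ℝ) 1) →
            ∫ ω, ∏ j, t j ^ Y ω j ∂(ProbabilityTheory.cond P (X ⁻¹' {x}))
              = MeixnerLancaster.conditionalPgf α θ β p Q x t)) ∧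
    -- the one-to-one reparametrization `ξ ↦ (β, Q)`, away from the point of independence `ξ = 0`
    Set.BijOn (fun ξ => (MeixnerLancaster.betaOf θ ξ, MeixnerLancaster.transitionOf θ p u ξ))
      {ξ | ξ ∈ MeixnerLancaster.unitSimplex m ∧ ξ ≠ 0 ∧
        MeixnerLancaster.IsLancasterSequence θ p u (MeixnerLancaster.pointSequence u ξ)}
      {b | 0 < b.1 ∧ b.1 ≤ 1 ∧ MeixnerLancaster.IsReversibleTransition p u b.2} ∧
    -- the extreme point `ξ` gives the transition function of the birth-death-immigration chain
    -- with parameters `(β, Q)` exactly when `(β, Q)` corresponds to `ξ`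
    (∀ ξ ∈ MeixnerLancaster.unitSimplex m,
      ∀ (β : ℝ) (Q : Matrix (Fin (m + 1)) (Fin (m + 1)) ℝ),
        0 ≤ β → β ≤ 1 → MeixnerLancaster.IsReversibleTransition p u Q →
        ((∀ α : ℝ, 0 < α → ∀ x y : Fin (m + 1) → ℕ,
            MeixnerLancaster.lancasterMass α θ p u (MeixnerLancaster.pointSequence u ξ) x y
              = MeixnerLancaster.meixnerMass α θ p x *
                (MeixnerLancaster.bdiTransition α β (MeixnerLancaster.kappa θ β) p Q x).real {y}) ↔
          β = MeixnerLancaster.betaOf θ ξ ∧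
            (ξ = 0 ∨ Q = MeixnerLancaster.transitionOf θ p u ξ))) := by
  refine ⟨MeixnerLancaster.bijOn_pointSequence hp hu, ?_, ⟨?_, ?_, ?_⟩, ?_⟩
  · intro α hα Ω _ P _ X Y hX hY
    constructor
    · rintro ⟨ρ, hρ, hL, hjoint⟩
      obtain ⟨ξ, hξ, rfl⟩ :=
        MeixnerLancaster.exists_pointSequence_eq_of_mem_extremePoints hp hu hρ
      obtain ⟨Q, hQ, h⟩ :=
        MeixnerLancaster.exists_admissible_of_isLancasterSequence hθ hp hp1 hu hξ hL
      obtain ⟨hβ0, hβ1⟩ := MeixnerLancaster.betaOf_mem hθ hξ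
      exact ⟨MeixnerLancaster.betaOf θ ξ, Q, hβ0, hβ1, hQ,
        (MeixnerLancaster.joint_eq_lancasterMass_iff hα hθ hp hp1 hu hξ hQ h P hX hY).1 hjoint⟩
    · rintro ⟨β, Q, hβ0, hβ1, hQ, hlaw⟩
      obtain ⟨ξ, hξ, rfl, h⟩ :=
        MeixnerLancaster.exists_point_of_admissible hθ hp hp1 hu hβ0 hβ1 hQ
      exact ⟨_, MeixnerLancaster.pointSequence_mem_extremePoints hp hu hξ,
        MeixnerLancaster.isLancasterSequence_of_isReversibleTransition hθ hp hp1 hu hξ hQ h,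
        (MeixnerLancaster.joint_eq_lancasterMass_iff hα hθ hp hp1 hu hξ hQ h P hX hY).2 hlaw⟩
  · rintro ξ ⟨hξ, h0, hL⟩
    exact ⟨MeixnerLancaster.betaOf_pos hθ hξ h0, (MeixnerLancaster.betaOf_mem hθ hξ).2,
      MeixnerLancaster.isReversibleTransition_transitionOf hθ hp hp1 hu hξ h0
        (MeixnerLancaster.transitionOf_nonneg_of_isLancasterSequence hθ hp hp1 hu hξ h0 hL)⟩
  · rintro ξ ⟨hξ, -, -⟩ η ⟨hη, -, -⟩ h
    exact MeixnerLancaster.injOn_betaOf_transitionOf hθ hp hu hξ hη (congrArg Prod.fst h)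
      (congrArg Prod.snd h)
  · rintro ⟨β, Q⟩ ⟨hβ0, hβ1, hQ⟩
    obtain ⟨ξ, hξ, h0, h1, h2⟩ :=
      MeixnerLancaster.exists_of_isReversibleTransition hθ hp hp1 hu hβ0 hβ1 hQ
    exact ⟨ξ, ⟨hξ, h0, MeixnerLancaster.isLancasterSequence_of_isReversibleTransition
      hθ hp hp1 hu hξ hQ (Or.inr h2.symm)⟩, Prod.ext h1 h2⟩
  · intro ξ hξ β Q hβ0 hβ1 hQ
    constructor
    · intro h
      exact MeixnerLancaster.eq_of_lancasterMass_eq hθ hp hp1 hu hξ hβ0 hβ1 hQ (h 1 one_pos)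
    · rintro ⟨rfl, h⟩ α hα x y
      exact MeixnerLancaster.lancasterMass_eq_mul_bdiTransition hα hθ hp hp1 hu hξ hQ h x y
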